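/- **Setting.** Let $k\ge 1$. The source is $S_{t+1}=AS_t+W_t$, $t\ge 0$, with $S_0, W_t\sim\mathcal N(0,Q)$, $Q\succ0$, where $A\in\mathbb R^{k\times k}$ has $k$ distinct real eigenvalues $\lambda_1,\dots,\lambda_k$ with $|\lambda_j|>1$. The channel is $Y_t=HX_t+Z_t$, $t\ge 0$, with $H\in\mathbb R^{m\times n}$, $Z_t\sim\mathcal N(0,R)$, $R\succ0$; let $h_1^2,\dots,h_n^2$ be the eigenvalues, with multiplicity, of $H^TR^{-1}H$ (so if $m=n$, $R=I$ and $H$ is diagonal, the $h_i$ may be taken to be its diagonal entries). A linear feedback encoder forms $$X_t=\sum_{s\le t}\Xi_{t,s}S_s+\sum_{s<t}\Psi_{t,s}Y_s+M_t,\qquad t\ge0,$$ with matrices $\Xi_{t,s},\Psi_{t,s}$ and Gaussian (possibly degenerate) $M_t$; the vectors $S_0$, $(W_t)$, $(Z_t)$, $(M_t)$ are mutually independent. Put $\hat S_t=\mathbb E[S_t\mid Y_0,\dots,Y_{t-1}]$, $P_t=\mathrm{Cov}(S_t-\hat S_t)$, $\Gamma_t=\mathbb E[X_t(S_t-\hat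 S_t)^T]$ and $\Omega_t=\mathbb E[X_tX_t^T]-\Gamma_tP_t^{-1}\Gamma_t^T$; for an encoder $X_t=\Gamma_tP_t^{-1}(S_t-\hat S_t)+M_t$ with centred $M_t$, $\Omega_t$ is the covariance of $M_t$. The encoder is *time-invariant* if $\Omega_t$ does not depend on $t$ and, moreover, either $\Gamma_t$ or the gain $\Gamma_tP_t^{-1}$ does not depend on $t$. Finite asymptotic error is *achievable with power $p\ge0$ by linear time-invariant encoders* if there are such an encoder and measurable decoders $\tilde S_t=g_t(Y_0,\dots,Y_{t-1})$ with $$\limsup_{T\to\infty}\frac1T\sum_{t=1}^T\mathbb E\|X_t\|^2\le p,\qquad \limsup_{T\to\infty}\frac1T\sum_{t=1}^T\mathbb E\|S_t-\tilde S_t\|^2\le D\ \text{ for some } D<\infty .$$ **Conjecture (Lyapunov positivity) for a pair of diagonal matrices $B=\mathrm{diag}(b_1,\dots,b_k)$, $\bar H=\mathrm{diag}(h_1,\dots,h_n)$.** Call $(\Gamma,\Pi,J)$, with $\Gamma\in\mathbb R^{n\times k}$, admissible if $\Pi\succeq0$ is diagonal, $J\succ0$ and $$J=BJB-\Gamma^T(I+\bar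 H\Pi \bar H)^{-1}\Gamma+B\Gamma^T\Gamma B .$$ If an admissible triple exists, then there is an optimal $\Gamma^*$ with exactly one non-zero entry in every column: the infimum of $\mathrm{Tr}(\Pi)$ over all $(\Pi,J)$ with $(\Gamma^*,\Pi,J)$ admissible (such pairs exist) equals the infimum of $\mathrm{Tr}(\Pi)$ over all admissible triples. **Theorem (vector source and MIMO channel, necessity).** Assume that the Lyapunov-positivity conjecture holds for $B=\mathrm{diag}(\lambda_1^{-1},\dots,\lambda_k^{-1})$ and $\bar H=\mathrm{diag}(h_1,\dots,h_n)$. Then finite asymptotic error is achievable with power $p$ by linear time-invariant encoders only if there exist a partition of $\{1,\dots,k\}$ into $n$ (possibly empty) sets $\mathcal S_1,\dots,\mathcal S_n$ and $\pi_1,\dots,\pi_n\ge0$ with $\sum_{i=1}^n\pi_i=p$ such that, for every $i$, $$\sum_{j\in\mathcal S_i}\log|\lambda_j|<\tfrac12\log(1+h_i^2\pi_i),$$ except that for $i$ with $h_i=0$ one has $\mathcal S_i=\emptyset$ instead. -/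

import Mathlib

open MeasureTheory ProbabilityTheory Filter
open scoped ENNReal Matrix

noncomputable section

/-! ### The Lyapunov-positivity conjecture -/

/-- `(Γ, Π, J)` is admissible for the trace minimisation with `B = diag(b)` and `H = diag(h)`:
`Π ⪰ 0` is diagonal, `J ≻ 0`, and
`J = B J B - Γᵀ (I + H Π H)⁻¹ Γ + B Γᵀ Γ B`. -/
structure LyapunovFeasible {k n : ℕ} (b : Fin k → ℝ) (h : Fin n → ℝ)
    (Γ : Matrix (Fin n) (Fin k) ℝ) (Pw : Matrix (Fin n) (Fin n) ℝ)
    (J : Matrix (Fin k) (Fin k) ℝ) : Prop where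
  power_posSemidef : Pw.PosSemidef
  power_isDiag : Pw.IsDiag
  posDef : J.PosDef
  lyapunov :
    J = Matrix.diagonal b * J * Matrix.diagonal b
      - Γᵀ * (1 + Matrix.diagonal h * Pw * Matrix.diagonal h)⁻¹ * Γ
      + Matrix.diagonal b * (Γᵀ * Γ) * Matrix.diagonal b

/-- The values of `tr Π` attainable with a given `Γ`. -/
def lyapunovTraces {k n : ℕ} (b : Fin k → ℝ) (h : Fin n → ℝ)
    (Γ : Matrix (Fin n) (Fin k) ℝ) : Set ℝ :=
  {x | ∃ Pw J, LyapunovFeasible b h Γ Pw J ∧ Pw.trace = x}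

/-- The values of `tr Π` attainable with any `Γ`. -/
def allLyapunovTraces {k n : ℕ} (b : Fin k → ℝ) (h : Fin n → ℝ) : Set ℝ :=
  {x | ∃ Γ, x ∈ lyapunovTraces b h Γ}

/-- Lyapunov positivity for the pair `B = diag(b)`, `H = diag(h)`: if the problem is feasible, then
some `Γ` with exactly one non-zero entry in each column is optimal, i.e. the infimum of `tr Π` over
the `(Π, J)` admissible with this `Γ` is the infimum of `tr Π` over all admissible `(Γ, Π, J)`.
(The infimum over `(Π, J)` need not be attained, because `J ≻ 0` is an open condition; a set of
reals with a greatest lower bound is non-empty, so `Γ` itself is admissible.) -/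
def LyapunovPositivity {k n : ℕ} (b : Fin k → ℝ) (h : Fin n → ℝ) : Prop :=
  (allLyapunovTraces b h).Nonempty →
    ∃ Γ : Matrix (Fin n) (Fin k) ℝ, (∀ j, ∃! i, Γ i j ≠ 0) ∧
      ∃ v : ℝ, IsGLB (allLyapunovTraces b h) v ∧ IsGLB (lyapunovTraces b h Γ) v

/-! ### Zero-delay linear feedback codes -/

/-- A zero-delay feedback code with a linear encoder, together with all random variables it
involves: the Gauss-Markov source with gain `A` and noise covariance `Q`, the additive white
Gaussian noise channel with gain `H` and noise covariance `R`, the linear encoder with independent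
Gaussian dither, and an arbitrary measurable decoder which forms its estimate of the state at
time `t` from the channel outputs at the times before `t`. -/
structure LinearCode {Ω : Type*} [MeasurableSpace Ω] (μ : Measure Ω) {k n m : ℕ}
    (A Q : Matrix (Fin k) (Fin k) ℝ) (H : Matrix (Fin m) (Fin n) ℝ)
    (R : Matrix (Fin m) (Fin m) ℝ) where
  /-- source state -/
  S : ℕ → Ω → EuclideanSpace ℝ (Fin k)
  /-- source noise -/
  W : ℕ → Ω → EuclideanSpace ℝ (Fin k)
  /-- channel input -/
  X : ℕ → Ω → EuclideanSpace ℝ (Fin n)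
  /-- encoder dither -/
  M : ℕ → Ω → EuclideanSpace ℝ (Fin n)
  /-- channel output -/
  Y : ℕ → Ω → EuclideanSpace ℝ (Fin m)
  /-- channel noise -/
  Z : ℕ → Ω → EuclideanSpace ℝ (Fin m)
  /-- encoder coefficients acting on the source states -/
  srcCoeff : ℕ → ℕ → Matrix (Fin n) (Fin k) ℝ
  /-- encoder coefficients acting on the fed back channel outputs -/
  fbCoeff : ℕ → ℕ → Matrix (Fin n) (Fin m) ℝ
  /-- decoder -/
  g : (t : ℕ) → (Fin t → EuclideanSpace ℝ (Fin m)) → EuclideanSpace ℝ (Fin k)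
  measurable_S_zero : Measurable (S 0)
  measurable_W : ∀ t, Measurable (W t)
  measurable_M : ∀ t, Measurable (M t)
  measurable_Z : ∀ t, Measurable (Z t)
  measurable_g : ∀ t, Measurable (g t)
  law_S_zero : μ.map (S 0) = multivariateGaussian 0 Q
  law_W : ∀ t, μ.map (W t) = multivariateGaussian 0 Q
  law_Z : ∀ t, μ.map (Z t) = multivariateGaussian 0 R
  /-- each dither vector is Gaussian, possibly degenerate (for instance zero) -/
  gaussian_M : ∀ t, IsGaussian (μ.map (M t))
  /-- the initial state and all the noise and dither vectors are mutually independent -/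
  indep : iIndep
    (Sum.elim (fun _ : Unit => MeasurableSpace.comap (S 0) inferInstance)
      (Sum.elim (fun t : ℕ => MeasurableSpace.comap (W t) inferInstance)
        (Sum.elim (fun t : ℕ => MeasurableSpace.comap (Z t) inferInstance)
          (fun t : ℕ => MeasurableSpace.comap (M t) inferInstance)))) μ
  source_eq : ∀ t ω, S (t + 1) ω = Matrix.toEuclideanLin A (S t ω) + W t ω
  encoder_eq : ∀ t ω, X t ω =
    ∑ s ∈ Finset.range (t + 1), Matrix.toEuclideanLin (srcCoeff t s) (S s ω)
      + ∑ s ∈ Finset.range t, Matrix.toEuclideanLin (fbCoeff t s) (Y s ω) + M t ω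
  channel_eq : ∀ t ω, Y t ω = Matrix.toEuclideanLin H (X t ω) + Z t ω

namespace LinearCode

variable {Ω : Type*} [MeasurableSpace Ω] {μ : Measure Ω} {k n m : ℕ}
  {A Q : Matrix (Fin k) (Fin k) ℝ} {H : Matrix (Fin m) (Fin n) ℝ}
  {R : Matrix (Fin m) (Fin m) ℝ}

/-- The channel outputs at the times before `t`. -/
def pastOutputs (c : LinearCode μ A Q H R) (t : ℕ) (ω : Ω) :
    Fin t → EuclideanSpace ℝ (Fin m) :=
  fun s => c.Y s ω

/-- The decoder's estimate of the state at time `t`. -/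
def estimate (c : LinearCode μ A Q H R) (t : ℕ) (ω : Ω) : EuclideanSpace ℝ (Fin k) :=
  c.g t (c.pastOutputs t ω)

/-- The average transmit power is at most `p` in the long run. -/
def PowerConstraint (c : LinearCode μ A Q H R) (p : ℝ) : Prop :=
  limsup (fun T : ℕ => (∑ t ∈ Finset.Icc 1 T, ∫⁻ ω, ‖c.X t ω‖ₑ ^ 2 ∂μ) / (T : ℝ≥0∞)) atTop
    ≤ ENNReal.ofReal p

/-- The average mean-squared error is at most `D` in the long run. -/
def DistortionConstraint (c : LinearCode μ A Q H R) (D : ℝ) : Prop :=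
  limsup (fun T : ℕ =>
      (∑ t ∈ Finset.Icc 1 T, ∫⁻ ω, ‖c.S t ω - c.estimate t ω‖ₑ ^ 2 ∂μ) / (T : ℝ≥0∞)) atTop
    ≤ ENNReal.ofReal D

/-- The innovation `S_t - E[S_t | Y_0, …, Y_{t-1}]`: the error of the optimal decoder. -/
def innovation (c : LinearCode μ A Q H R) (t : ℕ) : Ω → EuclideanSpace ℝ (Fin k) :=
  fun ω => c.S t ω -
    (μ[c.S t | MeasurableSpace.comap (c.pastOutputs t) inferInstance]) ω

/-- The covariance matrix `P_t` of the (centred) innovation. -/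
def errorCov (c : LinearCode μ A Q H R) (t : ℕ) : Matrix (Fin k) (Fin k) ℝ :=
  Matrix.of fun i j => ∫ ω, c.innovation t ω i * c.innovation t ω j ∂μ

/-- The encoder parameter `Γ_t = E[X_t (S_t - Ŝ_t)ᵀ]`, with `Ŝ_t` the optimal estimate. -/
def crossCov (c : LinearCode μ A Q H R) (t : ℕ) : Matrix (Fin n) (Fin k) ℝ :=
  Matrix.of fun i j => ∫ ω, c.X t ω i * c.innovation t ω j ∂μ

/-- The second moment matrix `E[X_t X_tᵀ]` of the channel input. -/
def inputMoment (c : LinearCode μ A Q H R) (t : ℕ) : Matrix (Fin n) (Fin n) ℝ :=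
  Matrix.of fun i j => ∫ ω, c.X t ω i * c.X t ω j ∂μ

/-- The encoder parameter `E[X_t X_tᵀ] - Γ_t P_t⁻¹ Γ_tᵀ`: for the innovations encoder
`X_t = Γ_t P_t⁻¹ (S_t - Ŝ_t) + M_t` this is the covariance of the dither `M_t`. -/
def ditherCov (c : LinearCode μ A Q H R) (t : ℕ) : Matrix (Fin n) (Fin n) ℝ :=
  c.inputMoment t - c.crossCov t * (c.errorCov t)⁻¹ * (c.crossCov t)ᵀ

/-- The encoder is time-invariant: its dither parameter does not depend on time, and neither does
its parameter `Γ_t` or, alternatively, the gain `G = Γ_t P_t⁻¹` applied to the innovation. -/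
def IsTimeInvariant (c : LinearCode μ A Q H R) : Prop :=
  (∃ Om, ∀ t, c.ditherCov t = Om) ∧
    ((∃ Γ, ∀ t, c.crossCov t = Γ) ∨ (∃ G, ∀ t, c.crossCov t * (c.errorCov t)⁻¹ = G))

end LinearCode

/-- Finite long-term mean-squared error is achievable with power `p` by a zero-delay feedback code
with a linear time-invariant encoder. -/
def FiniteMSEAchievable.{u} {k n m : ℕ} (A Q : Matrix (Fin k) (Fin k) ℝ)
    (H : Matrix (Fin m) (Fin n) ℝ) (R : Matrix (Fin m) (Fin m) ℝ) (p : ℝ) : Prop :=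
  ∃ (Ω : Type u) (_ : MeasurableSpace Ω) (μ : Measure Ω) (_ : IsProbabilityMeasure μ)
    (c : LinearCode μ A Q H R) (D : ℝ),
    c.IsTimeInvariant ∧ c.PowerConstraint p ∧ c.DistortionConstraint D

end

/-! ### The partition and power allocation condition -/

/-- The capacity `½ log (1 + h² π)` of a scalar channel with gain `h` used with power `π`. -/
noncomputable def channelCapacity (h pw : ℝ) : ℝ := 1 / 2 * Real.log (1 + h ^ 2 * pw)

/-- `S_1, …, S_n` is a partition of the set of modes into `n` (possibly empty) sets and `pw` is a
power allocation of total power `p` such that each channel has enough capacity for its modes. A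
channel of gain zero, which has no capacity at all, is only allowed the empty set of modes. -/
structure IsStabilizingAllocation {k n : ℕ} (lam : Fin k → ℝ) (h : Fin n → ℝ) (p : ℝ)
    (S : Fin n → Finset (Fin k)) (pw : Fin n → ℝ) : Prop where
  disjoint : ∀ i i', i ≠ i' → Disjoint (S i) (S i')
  cover : ∀ j, ∃ i, j ∈ S i
  nonneg : ∀ i, 0 ≤ pw i
  sum_eq : ∑ i, pw i = p
  capacity : ∀ i, (∑ j ∈ S i, Real.log |lam j| < channelCapacity (h i) (pw i)) ∨
    (h i = 0 ∧ S i = ∅)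

/-! ### Linear algebra -/

/-! The argument passes from the error covariance of a code to approximate fixed points of a Riccati
inequality, from these to admissible Lyapunov triples, and finally to capacities through a
determinant identity.

Every variable of a linear code is affine in independent Gaussian vectors, so the optimal decoding
error is independent of the past outputs. Its covariances obey `RiccatiBound`
(`LinearCode.riccatiBound_errorCov`) with `K = Hᵀ R⁻¹ H`, and the input power is at least the trace
of `Γ P⁻¹ Γᵀ`. The bound is written as a supremum over test vectors `v`, so for fixed `Γ` each of
its instances is affine in the covariances, while the power cost is a supremum of affine functions
of `P`. With constant `Γ`, long time averages are therefore approximate fixed points. With constant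
gain this linearity is lost; there the Riccati iterates started at `Q` increase, stay below the
error covariances, and have arbitrarily small increments. Half of the positive definite noise term
pays for the approximation in both cases, and the other half remains as strict slack.

In modal coordinates the approximate fixed point reads as a Lyapunov inequality. The eigenvalues of
`diag(h) Γ P⁻¹ Γᵀ diag(h)` can be assigned to the channels without extra power
(`exists_diagonal_power_le`, by Birkhoff's theorem). The slack then permits the power to be
multiplied by `1 - η` while keeping `J ≻ 0` (`exists_lyapunovTrace_le`). Since `η` does not depend
on the precision of the fixed point, the infimum of admissible powers is at most `(1 - η) p`.

Lyapunov positivity gives a `Γ` with one non-zero entry per column and the same infimum. This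
infimum is positive, so it is strictly below `p`, and some triple with this `Γ` has power below `p`.
On the modes that share one channel, its Lyapunov equation equates rank-one perturbations of a
positive definite block of `J`. Taking determinants gives `(∏ λ_j)² < 1 + h² π`
(`LyapunovFeasible.sum_log_lt`). The unused power is then distributed over the channels. -/

/-- Two families with the same multiset of values differ by a permutation. -/
lemma exists_perm_of_map_eq {ι α : Type*} [Fintype ι] [DecidableEq ι] [DecidableEq α]
    {f g : ι → α} (h : Finset.univ.val.map f = Finset.univ.val.map g) :
    ∃ σ : Equiv.Perm ι, ∀ i, g (σ i) = f i := by
  have hc : ∀ a, Fintype.card {i // f i = a} = Fintype.card {i // g i = a} := by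
    intro a
    have := congrArg (Multiset.count a) h
    simp only [Multiset.count_map] at this
    simpa [Fintype.card_subtype, Finset.card, eq_comm] using this
  let e : ∀ a, {i // f i = a} ≃ {i // g i = a} := fun a => Fintype.equivOfCardEq (hc a)
  exact ⟨Equiv.ofFiberEquiv e, fun i => Equiv.ofFiberEquiv_map e i⟩

/-- A real symmetric matrix is diagonalised by an orthogonal matrix, with its eigenvalues in any
prescribed order. -/
lemma exists_orthogonal_diagonalization {n : ℕ} {M : Matrix (Fin n) (Fin n) ℝ}
    (hM : M.IsHermitian) (e : Fin n → ℝ)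
    (he : M.charpoly = ∏ i, (Polynomial.X - Polynomial.C (e i))) :
    ∃ U : Matrix (Fin n) (Fin n) ℝ, Uᵀ * U = 1 ∧ U * Uᵀ = 1 ∧ M = U * Matrix.diagonal e * Uᵀ := by
  have h1 := hM.roots_charpoly_eq_eigenvalues
  rw [he, Polynomial.roots_prod _ _ (by
    simp [Finset.prod_ne_zero_iff, Polynomial.X_sub_C_ne_zero])] at h1
  simp only [Polynomial.roots_X_sub_C, Multiset.bind_singleton] at h1
  -- Both families list the roots of the same characteristic polynomial, so they differ by a
  -- permutation, which is applied to the columns of the eigenvector matrix.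
  obtain ⟨σ, hσ⟩ := exists_perm_of_map_eq h1
  set V : Matrix (Fin n) (Fin n) ℝ := hM.eigenvectorUnitary.1 with hV
  have hV1 : Vᵀ * V = 1 := by
    have := Unitary.star_mul_self_of_mem hM.eigenvectorUnitary.2
    simpa [Matrix.star_eq_conjTranspose, hV] using this
  have hMV : M = V * Matrix.diagonal hM.eigenvalues * Vᵀ := by
    have := hM.spectral_theorem
    rw [Unitary.conjStarAlgAut_apply] at this
    simpa [Matrix.star_eq_conjTranspose, hV, Function.comp_def] using this
  refine ⟨V.submatrix id σ, ?_, ?_, ?_⟩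
  · rw [Matrix.transpose_submatrix, Matrix.submatrix_mul _ _ _ id _ Function.bijective_id |>.symm,
      hV1, Matrix.submatrix_one_equiv]
  · rw [Matrix.transpose_submatrix, Matrix.submatrix_mul_equiv, mul_eq_one_comm.1 hV1,
      Matrix.submatrix_one _ Function.injective_id]
  · have : Matrix.diagonal e = (Matrix.diagonal hM.eigenvalues).submatrix σ σ := by
      rw [Matrix.submatrix_diagonal_equiv]
      congr 1
      ext i
      simpa using (hσ i).symm
    rw [this, Matrix.transpose_submatrix, Matrix.submatrix_mul_equiv, Matrix.submatrix_mul_equiv,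
      ← hMV, Matrix.submatrix_id_id]

/-- The discrete Lyapunov operator of a contraction is monotone. -/
lemma posDef_of_lyapunov_pos {k : ℕ} {b : Fin k → ℝ} (hb : ∀ j, |b j| < 1)
    {X : Matrix (Fin k) (Fin k) ℝ} (hX : X.IsHermitian)
    (h : ∀ u : Fin k → ℝ, u ≠ 0 → (b * u) ⬝ᵥ X *ᵥ (b * u) < u ⬝ᵥ X *ᵥ u) : X.PosDef := by
  have hle : ∀ u : Fin k → ℝ, (b * u) ⬝ᵥ X *ᵥ (b * u) ≤ u ⬝ᵥ X *ᵥ u := by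
    intro u
    by_cases hu : u = 0
    · simp [hu]
    · exact (h u hu).le
  have hnn : ∀ u : Fin k → ℝ, 0 ≤ u ⬝ᵥ X *ᵥ u := by
    intro u
    have hlim : Tendsto (fun N : ℕ => (b ^ N * u) ⬝ᵥ X *ᵥ (b ^ N * u)) atTop (nhds 0) := by
      have h0 : Tendsto (fun N : ℕ => b ^ N * u) atTop (nhds 0) := by
        rw [tendsto_pi_nhds]
        intro j
        simpa using (tendsto_pow_atTop_nhds_zero_of_abs_lt_one (hb j)).mul_const (u j)
      have hc : Continuous fun v : Fin k → ℝ => v ⬝ᵥ X *ᵥ v := by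
        unfold dotProduct Matrix.mulVec dotProduct
        fun_prop
      have := (hc.tendsto 0).comp h0
      simp only [zero_dotProduct] at this
      exact this
    -- Iterating the inequality bounds the form at `u` below by the form at `b ^ N * u`, which tends
    -- to zero by contraction.
    refine le_of_tendsto' hlim fun N => ?_
    induction N with
    | zero => simp
    | succ N ih =>
      rw [pow_succ', mul_assoc]
      exact (hle _).trans ih
  refine Matrix.PosDef.of_dotProduct_mulVec_pos hX fun u hu => ?_
  simpa using (hnn (b * u)).trans_lt (h u hu)

/-- The noise-to-output matrix of parallel channels is diagonal. -/
lemma inv_one_add_diagonal {n : ℕ} (h : Fin n → ℝ) {Pw : Matrix (Fin n) (Fin n) ℝ}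
    (hd : Pw.IsDiag) (hp : Pw.PosSemidef) :
    (1 + Matrix.diagonal h * Pw * Matrix.diagonal h)⁻¹
      = Matrix.diagonal fun i => (1 + h i ^ 2 * Pw i i)⁻¹ := by
  have hpos : ∀ i, 0 < 1 + h i ^ 2 * Pw i i := fun i => by
    have : 0 ≤ Pw i i := hp.diag_nonneg
    positivity
  have h1 : 1 + Matrix.diagonal h * Pw * Matrix.diagonal h
      = Matrix.diagonal fun i => 1 + h i ^ 2 * Pw i i := by
    rw [← hd.diagonal_diag, Matrix.diagonal_mul_diagonal, Matrix.diagonal_mul_diagonal,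
      ← Matrix.diagonal_one, Matrix.diagonal_add]
    congr 1
    ext i
    simp
    ring
  rw [h1]
  refine Matrix.inv_eq_left_inv ?_
  rw [Matrix.diagonal_mul_diagonal, ← Matrix.diagonal_one]
  congr 1
  ext i
  exact inv_mul_cancel₀ (hpos i).ne'

/-! ### The determinant bound on a single channel -/

/-- Within a set of modes that share one scalar channel, admissibility bounds the instability. -/
lemma LyapunovFeasible.sum_log_lt {k n : ℕ} {lam : Fin k → ℝ} {h : Fin n → ℝ}
    (hlam : ∀ j, 1 < |lam j|)
    {Γ : Matrix (Fin n) (Fin k) ℝ} {Pw : Matrix (Fin n) (Fin n) ℝ} {J : Matrix (Fin k) (Fin k) ℝ}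
    (hf : LyapunovFeasible (fun j => (lam j)⁻¹) h Γ Pw J) (hΓ : ∀ j, ∃! i, Γ i j ≠ 0)
    (i : Fin n) (hne : (Finset.univ.filter fun j => Γ i j ≠ 0).Nonempty) :
    ∑ j ∈ Finset.univ.filter (fun j => Γ i j ≠ 0), Real.log |lam j|
      < channelCapacity (h i) (Pw i i) := by
  have hg : 0 ≤ h i ^ 2 * Pw i i := by
    have : 0 ≤ Pw i i := hf.power_posSemidef.diag_nonneg
    positivity
  set g := h i ^ 2 * Pw i i with hgdef
  let ι := {j // Γ i j ≠ 0}
  let γ : ι → ℝ := fun j => Γ i j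
  let D : Matrix ι ι ℝ := Matrix.diagonal fun j => (lam j)⁻¹
  let J' : Matrix ι ι ℝ := J.submatrix (fun j : ι => (j : Fin k)) fun j : ι => (j : Fin k)
  have hJ' : J'.PosDef := hf.posDef.submatrix Subtype.val_injective
  have hzero : ∀ (c : Fin n) (j : ι), c ≠ i → Γ c j = 0 := by
    intro c j hc
    by_contra hcj
    exact hc ((hΓ j).unique hcj j.2)
  have hsum : ∀ (a b : ι) (w : Fin n → ℝ),
      ∑ c, Γ c a * w c * Γ c b = w i * (γ a * γ b) := by
    intro a b w
    rw [Finset.sum_eq_single i (fun c _ hc => by simp [hzero c a hc]) (by simp)]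
    simp only [γ]
    ring
  -- On these modes only row `i` of `Γ` survives, so both `Γ`-terms of the Lyapunov equation have
  -- rank one.
  have heq : J' + Matrix.replicateCol Unit ((1 + g)⁻¹ • γ) * Matrix.replicateRow Unit γ
      = D * (J' + Matrix.replicateCol Unit γ * Matrix.replicateRow Unit γ) * D := by
    ext a b
    have h1 := congrFun (congrFun hf.lyapunov a) b
    rw [inv_one_add_diagonal h hf.power_isDiag hf.power_posSemidef] at h1
    have h2 : (Γᵀ * Matrix.diagonal (fun c => (1 + h c ^ 2 * Pw c c)⁻¹) * Γ :
        Matrix (Fin k) (Fin k) ℝ) a b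
        = (1 + g)⁻¹ * (γ a * γ b) := by
      rw [Matrix.mul_apply]
      simp only [Matrix.mul_diagonal, Matrix.transpose_apply]
      exact hsum a b fun c => (1 + h c ^ 2 * Pw c c)⁻¹
    have h3 : (Γᵀ * Γ : Matrix (Fin k) (Fin k) ℝ) a b = γ a * γ b := by
      rw [Matrix.mul_apply]
      simpa using hsum a b 1
    rw [Matrix.add_apply, Matrix.sub_apply, h2, Matrix.mul_diagonal, Matrix.diagonal_mul,
      Matrix.mul_diagonal, Matrix.diagonal_mul, h3] at h1
    simp only [J', D, Matrix.add_apply, Matrix.mul_diagonal, Matrix.diagonal_mul]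
    simp only [Matrix.submatrix_apply, Matrix.mul_apply, Matrix.replicateCol_apply,
      Matrix.replicateRow_apply, Pi.smul_apply, smul_eq_mul, Finset.univ_unique,
      Finset.sum_singleton]
    linarith
  have hdet := congrArg Matrix.det heq
  have hu : IsUnit J'.det := hJ'.det_pos.ne'.isUnit
  set x : ℝ := γ ⬝ᵥ J'⁻¹ *ᵥ γ with hx
  have hx' : ∀ c : ℝ, (1 + Matrix.replicateRow Unit γ * J'⁻¹ *
      Matrix.replicateCol Unit (c • γ)).det = 1 + c * x := by
    intro c
    rw [Matrix.det_unique, Matrix.add_apply, Matrix.one_apply_eq, Matrix.mul_assoc,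
      ← Matrix.replicateCol_mulVec, hx]
    congr 1
    rw [Matrix.mulVec_smul, Matrix.replicateRow_mul_replicateCol_apply, dotProduct_smul,
      smul_eq_mul]
  have hγ : γ ≠ 0 := by
    obtain ⟨j, hj⟩ := hne
    have hj' : Γ i j ≠ 0 := by simpa using hj
    intro h0
    exact hj' (congrFun h0 ⟨j, hj'⟩)
  have hxpos : 0 < x := by
    have := hJ'.inv.dotProduct_mulVec_pos hγ
    simpa using this
  rw [Matrix.det_add_replicateCol_mul_replicateRow hu, hx', Matrix.det_mul, Matrix.det_mul,
    Matrix.det_add_replicateCol_mul_replicateRow hu,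
    show Matrix.replicateCol Unit γ = Matrix.replicateCol Unit ((1 : ℝ) • γ) by rw [one_smul],
    hx', Matrix.det_diagonal] at hdet
  have hprod : ∏ j : ι, (lam j)⁻¹ = (∏ j : ι, lam j)⁻¹ := by simp
  rw [hprod] at hdet
  have hL0 : ∏ j : ι, lam j ≠ 0 := by
    refine Finset.prod_ne_zero_iff.2 fun j _ => ?_
    have := hlam j
    intro h0
    rw [h0] at this
    norm_num at this
  set L := (∏ j : ι, lam j) ^ 2 with hL
  -- The matrix determinant lemma on both sides, with the common factor `det J'` cancelled; here `x
  -- = γᵀ J'⁻¹ γ > 0`.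
  have hLeq : L * (1 + (1 + g)⁻¹ * x) = 1 + x := by
    have hd := hJ'.det_pos.ne'
    rw [hL]
    field_simp at hdet ⊢
    linarith
  have hLlog : Real.log L = 2 * ∑ j ∈ Finset.univ.filter (fun j => Γ i j ≠ 0), Real.log |lam j| := by
    rw [hL, Real.log_pow, ← Real.log_abs, Finset.abs_prod, Real.log_prod]
    · push_cast
      congr 1
      exact (Finset.sum_subtype (p := fun j => Γ i j ≠ 0) _ (by simp) fun j => Real.log |lam j|).symm
    · intro j _
      linarith [hlam j]
  have hlogpos : 0 < Real.log L := by
    rw [hLlog]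
    have := Finset.sum_pos (s := Finset.univ.filter (fun j => Γ i j ≠ 0))
      (f := fun j => Real.log |lam j|) (fun j _ => Real.log_pos (hlam j)) hne
    linarith
  have hLpos : 0 < L := by positivity
  have hL1 : 1 < L := (Real.log_pos_iff hLpos.le).1 hlogpos
  -- If `L ≥ 1 + g`, the identity forces `g = 0`, and then `L = 1`, whereas unstable modes give `L >
  -- 1`.
  have hLlt : L < 1 + g := by
    by_contra hcon
    push Not at hcon
    have h1 : (1 + g) * (1 + (1 + g)⁻¹ * x) = 1 + g + x := by
      field_simp
    have h2 : (1 + g) * (1 + (1 + g)⁻¹ * x) ≤ L * (1 + (1 + g)⁻¹ * x) := by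
      gcongr
    have h3 : g = 0 := by linarith
    rw [h3] at hLeq
    nlinarith
  have := Real.log_lt_log hLpos hLlt
  unfold channelCapacity
  rw [← hgdef]
  linarith

/-! ### Matching eigenvalues with channels -/

/-- Diagonalising `diag(h) Σ diag(h)` by an orthogonal matrix, one can match its eigenvalues with
the channels in such a way that producing them with a diagonal input covariance does not cost more
power than `Σ`. -/
lemma exists_diagonal_power_le {n : ℕ} (h : Fin n → ℝ) {Sg : Matrix (Fin n) (Fin n) ℝ}
    (hS : Sg.PosSemidef) :
    ∃ (U : Matrix (Fin n) (Fin n) ℝ) (d : Fin n → ℝ) (σ : Equiv.Perm (Fin n)) (pw : Fin n → ℝ),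
      Uᵀ * U = 1 ∧ U * Uᵀ = 1 ∧
      Uᵀ * (Matrix.diagonal h * Sg * Matrix.diagonal h) * U = Matrix.diagonal d ∧
      (∀ i, 0 ≤ d i) ∧ (∀ i, 0 ≤ pw i) ∧ (∀ i, h i ^ 2 * pw i = d (σ i)) ∧
      ∑ i, pw i ≤ Sg.trace := by
  set M := Matrix.diagonal h * Sg * Matrix.diagonal h with hM
  have hMp : M.PosSemidef := by
    have := hS.mul_mul_conjTranspose_same (Matrix.diagonal h)
    simpa [hM, Matrix.diagonal_transpose] using this
  set d := hMp.1.eigenvalues with hd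
  have hd0 : ∀ i, 0 ≤ d i := hMp.eigenvalues_nonneg
  obtain ⟨U, hU1, hU2, hMU⟩ := exists_orthogonal_diagonalization hMp.1 d hMp.1.charpoly_eq
  have hMii : ∀ i, h i ^ 2 * Sg i i = ∑ j, U i j ^ 2 * d j := by
    intro i
    have h1 : M i i = h i ^ 2 * Sg i i := by
      rw [hM, Matrix.mul_diagonal, Matrix.diagonal_mul]
      ring
    rw [← h1, hMU, Matrix.mul_apply]
    simp only [Matrix.mul_diagonal, Matrix.transpose_apply]
    exact Finset.sum_congr rfl fun j _ => by ring
  -- The squared entries of an orthogonal matrix are doubly stochastic, so the diagonal `h i ^ 2 *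
  -- Sg i i` is a convex combination of permutations of the eigenvalues.
  have hDS : (Matrix.of fun i j => U i j ^ 2) ∈ doublyStochastic ℝ (Fin n) := by
    rw [mem_doublyStochastic_iff_sum]
    refine ⟨fun i j => sq_nonneg _, fun i => ?_, fun j => ?_⟩
    · have := congrFun (congrFun hU2 i) i
      rw [Matrix.mul_apply, Matrix.one_apply_eq] at this
      simpa [pow_two] using this
    · have := congrFun (congrFun hU1 j) j
      rw [Matrix.mul_apply, Matrix.one_apply_eq] at this
      simpa [pow_two] using this
  obtain ⟨w, hw0, hw1, hw⟩ := exists_eq_sum_perm_of_mem_doublyStochastic hDS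
  have hlin : ∀ i, ∑ τ, w τ * d (τ i) = h i ^ 2 * Sg i i := by
    intro i
    have hU : ∀ j, U i j ^ 2 = ∑ τ, w τ * (if τ i = j then 1 else 0) := by
      intro j
      have := congrFun (congrFun hw i) j
      simp only [Matrix.sum_apply, Matrix.smul_apply, Matrix.of_apply, smul_eq_mul,
        Equiv.Perm.permMatrix, PEquiv.toMatrix_apply, Equiv.toPEquiv_apply, Option.mem_def,
        Option.some.injEq] at this
      exact this.symm
    rw [hMii]
    simp only [hU, Finset.sum_mul]
    rw [Finset.sum_comm]
    refine Finset.sum_congr rfl fun τ _ => ?_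
    simp
  -- Division by zero makes a channel of gain zero free of charge; that such a channel also receives
  -- eigenvalue zero is checked at the end.
  let cost : Equiv.Perm (Fin n) → ℝ := fun τ => ∑ i, d (τ i) / h i ^ 2
  have hcost : ∑ τ, w τ * cost τ ≤ Sg.trace := by
    simp only [cost, Finset.mul_sum]
    rw [Finset.sum_comm]
    refine Finset.sum_le_sum fun i _ => ?_
    have h1 : ∑ τ, w τ * (d (τ i) / h i ^ 2) = (h i ^ 2 * Sg i i) / h i ^ 2 := by
      rw [← hlin, Finset.sum_div]
      exact Finset.sum_congr rfl fun τ _ => by ring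
    rw [h1, Matrix.diag_apply]
    by_cases hi : h i = 0
    · simpa [hi] using hS.diag_nonneg
    · rw [mul_div_cancel_left₀ _ (pow_ne_zero 2 hi)]
  -- The weighted average of the costs is at most the trace, so some permutation of positive weight
  -- is that cheap. Positivity of the weight matters at `h i = 0`: there the average of the
  -- nonnegative `d (τ i)` vanishes, hence so does `d (σ i)`.
  obtain ⟨σ, hσ0, hσ⟩ : ∃ σ, 0 < w σ ∧ cost σ ≤ Sg.trace := by
    by_contra hcon
    push Not at hcon
    have h1 : ∑ τ, w τ * Sg.trace < ∑ τ, w τ * cost τ := by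
      refine Finset.sum_lt_sum (fun τ _ => ?_) ?_
      · rcases (hw0 τ).eq_or_lt with h0 | h0
        · simp [← h0]
        · exact mul_le_mul_of_nonneg_left (hcon τ h0).le h0.le
      · obtain ⟨τ, -, hτ⟩ := Finset.exists_lt_of_sum_lt (s := Finset.univ) (f := fun _ => (0 : ℝ))
          (g := w) (by simp [hw1])
        exact ⟨τ, Finset.mem_univ _, mul_lt_mul_of_pos_left (hcon τ hτ) hτ⟩
    rw [← Finset.sum_mul, hw1, one_mul] at h1
    linarith
  refine ⟨U, d, σ, fun i => d (σ i) / h i ^ 2, hU1, hU2, ?_, hd0,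
    fun i => div_nonneg (hd0 _) (sq_nonneg _), fun i => ?_, hσ⟩
  · rw [hMU, ← Matrix.mul_assoc, ← Matrix.mul_assoc, hU1, Matrix.one_mul, Matrix.mul_assoc, hU1,
      Matrix.mul_one]
  · by_cases hi : h i = 0
    · have h1 := hlin i
      rw [hi] at h1
      simp only [ne_eq, OfNat.ofNat_ne_zero, not_false_eq_true, zero_pow, zero_mul] at h1
      have h2 := (Finset.sum_eq_zero_iff_of_nonneg
        (fun τ _ => mul_nonneg (hw0 τ) (hd0 (τ i)))).1 h1 σ (Finset.mem_univ _)
      have h3 : d (σ i) = 0 := (mul_eq_zero.1 h2).resolve_left hσ0.ne'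
      simp [hi, h3]
    · exact mul_div_cancel₀ _ (pow_ne_zero 2 hi)

lemma dotProduct_mulVec_sub_self {k : ℕ} {P : Matrix (Fin k) (Fin k) ℝ} (hP : P.IsHermitian)
    (u y : Fin k → ℝ) :
    (u - y) ⬝ᵥ P *ᵥ (u - y) = u ⬝ᵥ P *ᵥ u - 2 * (u ⬝ᵥ P *ᵥ y) + y ⬝ᵥ P *ᵥ y := by
  have hsymm : y ⬝ᵥ P *ᵥ u = u ⬝ᵥ P *ᵥ y := by
    rw [Matrix.dotProduct_mulVec, ← Matrix.mulVec_transpose, dotProduct_comm]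
    have : Pᵀ = P := by simpa using hP.eq
    rw [this]
  simp only [Matrix.mulVec_sub, sub_dotProduct, dotProduct_sub, hsymm]
  ring

lemma dotProduct_transpose_mulVec {k n : ℕ} (Γ : Matrix (Fin n) (Fin k) ℝ) (u : Fin k → ℝ)
    (z : Fin n → ℝ) : u ⬝ᵥ Γᵀ *ᵥ z = Γ *ᵥ u ⬝ᵥ z := by
  rw [Matrix.dotProduct_mulVec, Matrix.vecMul_transpose]

/-! ### From a Riccati inequality to an admissible triple -/

/-- A strict approximate solution of the Riccati inequality in modal coordinates yields an
admissible triple, with a fraction `η` of the power to spare. -/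
lemma exists_lyapunovTrace_le {k n : ℕ} {b : Fin k → ℝ} (hb : ∀ j, |b j| < 1) (h : Fin n → ℝ)
    {P : Matrix (Fin k) (Fin k) ℝ} (hP : P.PosDef) (Γ : Matrix (Fin n) (Fin k) ℝ)
    {η : ℝ} (hη0 : 0 ≤ η) (hη1 : η < 1) (c : (Fin k → ℝ) → ℝ)
    (hc : ∀ u, u ≠ 0 → η / (1 - η) * (u ⬝ᵥ P *ᵥ u) < c u)
    (hineq : ∀ u v, c u + u ⬝ᵥ P *ᵥ u - v ⬝ᵥ P *ᵥ v
        - (Matrix.diagonal h * Γ) *ᵥ (u - v) ⬝ᵥ (Matrix.diagonal h * Γ) *ᵥ (u - v)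
      ≤ (b * u) ⬝ᵥ P *ᵥ (b * u)) :
    ∃ x ∈ allLyapunovTraces b h, x ≤ (1 - η) * (Γ * P⁻¹ * Γᵀ).trace := by
  have hPdet : IsUnit P.det := hP.det_pos.ne'.isUnit
  have hPP : ∀ w, P *ᵥ (P⁻¹ *ᵥ w) = w := fun w => by
    rw [Matrix.mulVec_mulVec, Matrix.mul_nonsing_inv _ hPdet, Matrix.one_mulVec]
  have hSg : (Γ * P⁻¹ * Γᵀ).PosSemidef := by
    simpa using hP.inv.posSemidef.mul_mul_conjTranspose_same Γ
  obtain ⟨U, d, σ, pw, hU1, hU2, hUd, hd0, hpw0, hpwd, hpwsum⟩ := exists_diagonal_power_le h hSg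
  set Γr : Matrix (Fin n) (Fin k) ℝ := Uᵀ * (Matrix.diagonal h * Γ) with hΓr
  have hΓrP : Γr * P⁻¹ * Γrᵀ = Matrix.diagonal d := by
    rw [← hUd, hΓr]
    simp only [Matrix.transpose_mul, Matrix.diagonal_transpose, Matrix.transpose_transpose,
      Matrix.mul_assoc]
  have hrow : ∀ i, d i = 0 → ∀ j, Γr i j = 0 := by
    intro i hi
    have h1 := congrFun (congrFun hΓrP i) i
    rw [Matrix.diagonal_apply_eq, hi, Matrix.mul_assoc] at h1
    have h2 : Γr i ⬝ᵥ P⁻¹ *ᵥ Γr i = 0 := h1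
    by_contra! hcon
    obtain ⟨j, hj⟩ := hcon
    have := hP.inv.dotProduct_mulVec_pos (x := Γr i) fun h0 => hj (congrFun h0 j)
    simp only [star_trivial] at this
    linarith
  -- Normalised rows: `Γn P⁻¹ Γnᵀ` is a diagonal projection. The rows with `d i = 0` vanish already
  -- in `Γr`, so the default value of the inverse is harmless.
  set Γn : Matrix (Fin n) (Fin k) ℝ := Matrix.diagonal (fun i => (√(d i))⁻¹) * Γr with hΓn
  have hz : ∀ u i, d i * (Γn *ᵥ u) i ^ 2 = (Γr *ᵥ u) i ^ 2 := by
    intro u i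
    rw [hΓn, ← Matrix.mulVec_mulVec, Matrix.mulVec_diagonal]
    by_cases hi : d i = 0
    · have : (Γr *ᵥ u) i = 0 := by simp [Matrix.mulVec, dotProduct, hrow i hi]
      simp [this]
    · rw [mul_pow, inv_pow, Real.sq_sqrt (hd0 i)]
      field_simp
  -- This is `Γnᵀ Γn ⪯ P`, obtained by expanding the form of `P` at `u - y` with `y = P⁻¹ Γnᵀ Γn u`.
  have hkey1 : ∀ u, Γn *ᵥ u ⬝ᵥ Γn *ᵥ u ≤ u ⬝ᵥ P *ᵥ u := by
    intro u
    set z := Γn *ᵥ u with hzdef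
    set y := P⁻¹ *ᵥ (Γnᵀ *ᵥ z) with hy
    have h1 : Γn * P⁻¹ * Γnᵀ = Matrix.diagonal fun i => (√(d i))⁻¹ * d i * (√(d i))⁻¹ := by
      rw [hΓn, Matrix.transpose_mul, Matrix.diagonal_transpose, ← Matrix.diagonal_mul_diagonal,
        ← Matrix.diagonal_mul_diagonal, ← hΓrP]
      simp only [Matrix.mul_assoc]
    have h2 : y ⬝ᵥ P *ᵥ y ≤ z ⬝ᵥ z := by
      rw [hy, hPP, dotProduct_transpose_mulVec, Matrix.mulVec_mulVec, Matrix.mulVec_mulVec, h1]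
      refine Finset.sum_le_sum fun i _ => ?_
      rw [Matrix.mulVec_diagonal]
      have h3 : (√(d i))⁻¹ * d i * (√(d i))⁻¹ ≤ 1 := by
        by_cases hi : d i = 0
        · simp [hi]
        · have : √(d i) ≠ 0 := (Real.sqrt_ne_zero (hd0 i)).2 hi
          nth_rw 2 [← Real.mul_self_sqrt (hd0 i)]
          field_simp
          rfl
      nlinarith [mul_self_nonneg (z i)]
    have h3 : u ⬝ᵥ P *ᵥ y = z ⬝ᵥ z := by
      rw [hy, hPP, dotProduct_transpose_mulVec]
    have h4 := hP.posSemidef.dotProduct_mulVec_nonneg (u - y)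
    rw [star_trivial, dotProduct_mulVec_sub_self hP.1, h3] at h4
    linarith
  have hkey2 : ∀ u, c u + u ⬝ᵥ P *ᵥ u - ∑ i, d i / (1 + d i) * (Γn *ᵥ u) i ^ 2
      ≤ (b * u) ⬝ᵥ P *ᵥ (b * u) := by
    intro u
    set q := Γr *ᵥ u with hq
    set w : Fin n → ℝ := fun i => q i / (1 + d i) with hw
    -- The maximiser of the left side of `hineq`: it makes `Γr (u - v) = w`, so that the posterior
    -- covariance appears as `P - Γnᵀ diag(d / (1 + d)) Γn`.
    set v := P⁻¹ *ᵥ (Γrᵀ *ᵥ w) with hv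
    have hΓv : Γr *ᵥ v = fun i => d i * w i := by
      rw [hv, Matrix.mulVec_mulVec, Matrix.mulVec_mulVec, hΓrP]
      ext i
      rw [Matrix.mulVec_diagonal]
    have h1 : v ⬝ᵥ P *ᵥ v = ∑ i, d i * w i ^ 2 := by
      nth_rw 2 [hv]
      rw [hPP, dotProduct_transpose_mulVec, hΓv]
      exact Finset.sum_congr rfl fun i _ => by ring
    have h2 : Γr *ᵥ (u - v) = w := by
      rw [Matrix.mulVec_sub, hΓv]
      ext i
      have : (1 + d i) ≠ 0 := by linarith [hd0 i]
      simp only [Pi.sub_apply, hw, ← hq]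
      field_simp
      ring
    have h3 : (Matrix.diagonal h * Γ) *ᵥ (u - v) = U *ᵥ w := by
      rw [← h2, hΓr, Matrix.mulVec_mulVec, ← Matrix.mul_assoc, hU2, Matrix.one_mul]
    have h4 : U *ᵥ w ⬝ᵥ U *ᵥ w = ∑ i, w i ^ 2 := by
      rw [← dotProduct_transpose_mulVec, Matrix.mulVec_mulVec, hU1, Matrix.one_mulVec]
      exact Finset.sum_congr rfl fun i _ => by ring
    have h5 : ∑ i, d i / (1 + d i) * (Γn *ᵥ u) i ^ 2 = ∑ i, d i * w i ^ 2 + ∑ i, w i ^ 2 := by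
      rw [← Finset.sum_add_distrib]
      refine Finset.sum_congr rfl fun i _ => ?_
      have : (1 + d i) ≠ 0 := by linarith [hd0 i]
      rw [div_mul_eq_mul_div, hz u i]
      simp only [hw, ← hq]
      field_simp
      ring
    have := hineq u v
    rw [h3, h4, h1] at this
    rw [h5]
    linarith
  have hbb : ∀ a a', 1 - b a * b a' ≠ 0 := by
    intro a a' h0
    have h1 : |b a| * |b a'| < 1 :=
      mul_lt_one_of_nonneg_of_lt_one_left (abs_nonneg _) (hb a) (hb a').le
    rw [← abs_mul, show b a * b a' = 1 by linarith] at h1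
    norm_num at h1
  set N : Fin n → ℝ := fun i => (1 + (1 - η) * d i)⁻¹ with hN
  set Rm : Matrix (Fin k) (Fin k) ℝ := Matrix.diagonal b * (Γnᵀ * Γn) * Matrix.diagonal b
    - Γnᵀ * Matrix.diagonal N * Γn with hRm
  have hRmT : Rmᵀ = Rm := by
    simp only [hRm, Matrix.transpose_sub, Matrix.transpose_mul, Matrix.diagonal_transpose,
      Matrix.transpose_transpose, Matrix.mul_assoc]
  -- With `B` diagonal the Lyapunov equation decouples entrywise and is solved by division.
  set J : Matrix (Fin k) (Fin k) ℝ := Matrix.of fun a a' => Rm a a' / (1 - b a * b a') with hJ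
  have hJeq : J = Matrix.diagonal b * J * Matrix.diagonal b + Rm := by
    ext a a'
    rw [Matrix.add_apply, Matrix.mul_diagonal, Matrix.diagonal_mul]
    simp only [hJ, Matrix.of_apply]
    have := hbb a a'
    field_simp
    ring
  have hJT : J.IsHermitian := by
    ext a a'
    have h1 := congrFun (congrFun hRmT a) a'
    rw [Matrix.transpose_apply] at h1
    simp only [hJ, Matrix.conjTranspose_apply, Matrix.of_apply, star_trivial, h1, mul_comm (b a)]
  have hJ0 : (P - Γnᵀ * Γn).PosSemidef := by
    refine Matrix.PosSemidef.of_dotProduct_mulVec_nonneg ?_ fun u => ?_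
    · exact hP.1.sub (by simpa using Matrix.isHermitian_conjTranspose_mul_self Γn)
    · rw [star_trivial, Matrix.sub_mulVec, dotProduct_sub, ← Matrix.mulVec_mulVec,
        dotProduct_transpose_mulVec]
      linarith [hkey1 u]
  have hdiag : ∀ u : Fin k → ℝ, Matrix.diagonal b *ᵥ u = b * u := fun u => by
    ext i
    rw [Matrix.mulVec_diagonal, Pi.mul_apply]
  -- By `hkey2`, `P - Γnᵀ Γn` is a strict subsolution, with margin `c`, of the Lyapunov equation at
  -- full power. Lowering the power by the factor `1 - η` costs at most `η / (1 - η)` times the form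
  -- of `Γnᵀ Γn ⪯ P`, which `c` exceeds; hence `J` lies strictly above this positive semidefinite
  -- matrix.
  have hX : (J - (P - Γnᵀ * Γn)).PosDef := by
    refine posDef_of_lyapunov_pos hb (hJT.sub hJ0.1) fun u hu => ?_
    have h1 : u ⬝ᵥ J *ᵥ u = (b * u) ⬝ᵥ J *ᵥ (b * u) + Γn *ᵥ (b * u) ⬝ᵥ Γn *ᵥ (b * u)
        - ∑ i, N i * (Γn *ᵥ u) i ^ 2 := by
      have hconj : ∀ Y : Matrix (Fin k) (Fin k) ℝ,
          u ⬝ᵥ (Matrix.diagonal b * Y * Matrix.diagonal b) *ᵥ u = (b * u) ⬝ᵥ Y *ᵥ (b * u) := by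
        intro Y
        have hT := dotProduct_transpose_mulVec (Matrix.diagonal b) u (Y *ᵥ (b * u))
        rw [Matrix.diagonal_transpose, hdiag u] at hT
        rw [← Matrix.mulVec_mulVec, ← Matrix.mulVec_mulVec, hdiag u, hT]
      conv_lhs => rw [hJeq, hRm]
      rw [Matrix.add_mulVec, Matrix.sub_mulVec, dotProduct_add, dotProduct_sub, hconj, hconj]
      have h2 : u ⬝ᵥ (Γnᵀ * Matrix.diagonal N * Γn) *ᵥ u = ∑ i, N i * (Γn *ᵥ u) i ^ 2 := by
        rw [← Matrix.mulVec_mulVec, ← Matrix.mulVec_mulVec, dotProduct_transpose_mulVec]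
        refine Finset.sum_congr rfl fun i _ => ?_
        rw [Matrix.mulVec_diagonal]
        ring
      rw [h2, ← Matrix.mulVec_mulVec, dotProduct_transpose_mulVec]
      ring
    have h3 : ∀ i, -(η / (1 - η)) ≤ 1 - N i - d i / (1 + d i) := by
      intro i
      have hη : 0 < 1 - η := by linarith
      have hdi := hd0 i
      have h4 : 0 ≤ (1 - η) * d i := by positivity
      have h5 : 1 - N i - d i / (1 + d i)
          = -(η / (1 - η)) * (((1 - η) * d i / (1 + (1 - η) * d i)) * (1 / (1 + d i))) := by
        simp only [hN]
        field_simp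
        ring
      have h6 : ((1 - η) * d i / (1 + (1 - η) * d i)) * (1 / (1 + d i)) ≤ 1 := by
        refine mul_le_one₀ ?_ (by positivity) ?_
        · rw [div_le_one (by positivity)]
          linarith
        · rw [div_le_one (by positivity)]
          linarith
      rw [h5]
      have h7 : 0 ≤ η / (1 - η) := by positivity
      nlinarith
    have h4 : -(η / (1 - η)) * (Γn *ᵥ u ⬝ᵥ Γn *ᵥ u)
        ≤ Γn *ᵥ u ⬝ᵥ Γn *ᵥ u - ∑ i, N i * (Γn *ᵥ u) i ^ 2
          - ∑ i, d i / (1 + d i) * (Γn *ᵥ u) i ^ 2 := by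
      simp only [dotProduct, Finset.mul_sum, ← Finset.sum_sub_distrib]
      refine Finset.sum_le_sum fun i _ => ?_
      nlinarith [mul_le_mul_of_nonneg_right (h3 i) (sq_nonneg ((Γn *ᵥ u) i))]
    have h5 := hkey2 u
    have h6 := hc u hu
    have h7 : η / (1 - η) * (Γn *ᵥ u ⬝ᵥ Γn *ᵥ u) ≤ η / (1 - η) * (u ⬝ᵥ P *ᵥ u) :=
      mul_le_mul_of_nonneg_left (hkey1 u) (div_nonneg hη0 (by linarith))
    have h8 : ∀ u, u ⬝ᵥ (J - (P - Γnᵀ * Γn)) *ᵥ u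
        = u ⬝ᵥ J *ᵥ u - u ⬝ᵥ P *ᵥ u + Γn *ᵥ u ⬝ᵥ Γn *ᵥ u := by
      intro u
      rw [Matrix.sub_mulVec, Matrix.sub_mulVec, dotProduct_sub, dotProduct_sub,
        ← Matrix.mulVec_mulVec, dotProduct_transpose_mulVec]
      ring
    rw [h8, h8, h1]
    linarith
  have hJpos : J.PosDef := by
    have := hX.add_posSemidef hJ0
    simpa using this
  -- Permuting the rows by `σ` moves eigenvalue `d (σ i)` to channel `i`, where power `pw i`
  -- produces it.
  refine ⟨(1 - η) * ∑ i, pw i, ⟨Γn.submatrix σ id,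
    Matrix.diagonal fun i => (1 - η) * pw i, J, ⟨?_, Matrix.isDiag_diagonal _, hJpos, ?_⟩, ?_⟩, ?_⟩
  · rw [Matrix.posSemidef_diagonal_iff]
    exact fun i => mul_nonneg (by linarith) (hpw0 i)
  · have hps : (Matrix.diagonal fun i => (1 - η) * pw i).PosSemidef := by
      rw [Matrix.posSemidef_diagonal_iff]
      exact fun i => mul_nonneg (by linarith) (hpw0 i)
    rw [inv_one_add_diagonal h (Matrix.isDiag_diagonal _) hps]
    have h1 : (Matrix.diagonal fun i => (1 + h i ^ 2 *
        (Matrix.diagonal (fun i => (1 - η) * pw i) : Matrix (Fin n) (Fin n) ℝ) i i)⁻¹)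
        = (Matrix.diagonal N).submatrix σ σ := by
      rw [Matrix.submatrix_diagonal_equiv]
      congr 1
      ext i
      simp only [Matrix.diagonal_apply_eq, Function.comp_apply, hN, ← hpwd]
      congr 2
      ring
    rw [h1, Matrix.transpose_submatrix, Matrix.submatrix_mul_equiv, Matrix.submatrix_mul_equiv,
      Matrix.submatrix_mul_equiv, Matrix.submatrix_id_id, Matrix.submatrix_id_id]
    conv_lhs => rw [hJeq, hRm]
    abel
  · rw [Matrix.trace_diagonal, Finset.mul_sum]
  · exact mul_le_mul_of_nonneg_left hpwsum (by linarith)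

/-! ### Bounds for quadratic forms and their inverses -/

open scoped MatrixOrder in
lemma dotProduct_mulVec_le_trace {k : ℕ} {M : Matrix (Fin k) (Fin k) ℝ} (hM : M.PosSemidef)
    (x : Fin k → ℝ) : x ⬝ᵥ M *ᵥ x ≤ M.trace * (x ⬝ᵥ x) := by
  -- Factor `M = Cᵀ C` and apply the Cauchy–Schwarz inequality to each row of `C`.
  obtain ⟨C, hC⟩ := CStarAlgebra.nonneg_iff_eq_star_mul_self.1 hM.nonneg
  have hC' : M = Cᵀ * C := by simpa [Matrix.star_eq_conjTranspose] using hC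
  rw [hC', ← Matrix.mulVec_mulVec, dotProduct_transpose_mulVec, Matrix.trace]
  have h1 : ∀ i, (C *ᵥ x) i * (C *ᵥ x) i ≤ (∑ j, C i j ^ 2) * (x ⬝ᵥ x) := by
    intro i
    have := Finset.sum_mul_sq_le_sq_mul_sq Finset.univ (C i) x
    simpa [Matrix.mulVec, dotProduct, pow_two] using this
  calc C *ᵥ x ⬝ᵥ C *ᵥ x ≤ ∑ i, (∑ j, C i j ^ 2) * (x ⬝ᵥ x) := Finset.sum_le_sum fun i _ => h1 i
    _ = (∑ i, (Cᵀ * C).diag i) * (x ⬝ᵥ x) := by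
      rw [← Finset.sum_mul, Finset.sum_comm]
      simp [Matrix.mul_apply, pow_two]

lemma dotProduct_self_nonneg' {k : ℕ} (x : Fin k → ℝ) : 0 ≤ x ⬝ᵥ x :=
  Finset.sum_nonneg fun i _ => mul_self_nonneg (x i)

lemma Matrix.PosDef.mulVec_inv {k : ℕ} {M : Matrix (Fin k) (Fin k) ℝ} (hM : M.PosDef)
    (w : Fin k → ℝ) : M *ᵥ (M⁻¹ *ᵥ w) = w := by
  rw [Matrix.mulVec_mulVec, Matrix.mul_nonsing_inv _ hM.det_pos.ne'.isUnit, Matrix.one_mulVec]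

/-- Completing the square at `y = M⁻¹ w`. Together with the equality case below, it presents the
inverse form as a supremum of functions affine in `M`. -/
lemma Matrix.PosDef.le_inv_quadratic {k : ℕ} {M : Matrix (Fin k) (Fin k) ℝ} (hM : M.PosDef)
    (w y : Fin k → ℝ) : 2 * (w ⬝ᵥ y) - y ⬝ᵥ M *ᵥ y ≤ w ⬝ᵥ M⁻¹ *ᵥ w := by
  have h1 := hM.posSemidef.dotProduct_mulVec_nonneg (y - M⁻¹ *ᵥ w)
  rw [star_trivial, dotProduct_mulVec_sub_self hM.1, hM.mulVec_inv, dotProduct_comm y w,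
    dotProduct_comm (M⁻¹ *ᵥ w) w] at h1
  linarith

lemma Matrix.PosDef.inv_quadratic_eq {k : ℕ} {M : Matrix (Fin k) (Fin k) ℝ} (hM : M.PosDef)
    (w : Fin k → ℝ) :
    2 * (w ⬝ᵥ M⁻¹ *ᵥ w) - (M⁻¹ *ᵥ w) ⬝ᵥ M *ᵥ (M⁻¹ *ᵥ w) = w ⬝ᵥ M⁻¹ *ᵥ w := by
  rw [hM.mulVec_inv, dotProduct_comm (M⁻¹ *ᵥ w) w]
  ring

/-- The variational formula for the inverse decreases when `M` grows; the maximiser for `N` serves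
as test vector for `M`. -/
lemma Matrix.PosDef.inv_antitone {k : ℕ} {M N : Matrix (Fin k) (Fin k) ℝ} (hM : M.PosDef)
    (hN : N.PosDef) (h : ∀ u, u ⬝ᵥ M *ᵥ u ≤ u ⬝ᵥ N *ᵥ u) (w : Fin k → ℝ) :
    w ⬝ᵥ N⁻¹ *ᵥ w ≤ w ⬝ᵥ M⁻¹ *ᵥ w := by
  have h1 := hM.le_inv_quadratic w (N⁻¹ *ᵥ w)
  have h2 := hN.inv_quadratic_eq w
  have h3 := h (N⁻¹ *ᵥ w)
  linarith

lemma Matrix.PosDef.exists_pos_le {k : ℕ} {M : Matrix (Fin k) (Fin k) ℝ} (hM : M.PosDef) :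
    ∃ κ : ℝ, 0 < κ ∧ ∀ x, κ * (x ⬝ᵥ x) ≤ x ⬝ᵥ M *ᵥ x := by
  have ht := hM.inv.posSemidef.trace_nonneg
  -- The trace of `M⁻¹` bounds its largest eigenvalue; adding one keeps the denominator positive
  -- also in dimension zero.
  refine ⟨(M⁻¹.trace + 1)⁻¹, by positivity, fun x => ?_⟩
  set τ := (M⁻¹.trace + 1)⁻¹ with hτ
  have hτ0 : 0 < τ := by positivity
  have h1 := hM.inv.le_inv_quadratic x (τ • x)
  have h2 := dotProduct_mulVec_le_trace hM.inv.posSemidef x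
  rw [Matrix.nonsing_inv_nonsing_inv _ hM.det_pos.ne'.isUnit, Matrix.mulVec_smul,
    smul_dotProduct, dotProduct_smul, dotProduct_smul] at h1
  simp only [smul_eq_mul] at h1
  have h3 := dotProduct_self_nonneg' x
  have h4 : τ * (M⁻¹.trace + 1) = 1 := inv_mul_cancel₀ (by positivity)
  have h5 : τ * (τ * (x ⬝ᵥ M⁻¹ *ᵥ x)) ≤ τ * (x ⬝ᵥ x) := by
    refine mul_le_mul_of_nonneg_left ?_ hτ0.le
    calc τ * (x ⬝ᵥ M⁻¹ *ᵥ x) ≤ τ * ((M⁻¹.trace + 1) * (x ⬝ᵥ x)) := by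
          refine mul_le_mul_of_nonneg_left ?_ hτ0.le
          linarith
      _ = x ⬝ᵥ x := by rw [← mul_assoc, h4, one_mul]
  linarith

/-! ### The Riccati inequality in modal coordinates -/

/-- One step of the Riccati recursion for the error covariance, as a lower bound: `P'` dominates
`q + A P⁺ Aᵀ`, where `P⁺` is the posterior covariance after the observation of an input whose
covariance with the state is `Γ`, written as a supremum over `v`. -/
def RiccatiBound {k n : ℕ} (A : Matrix (Fin k) (Fin k) ℝ) (K : Matrix (Fin n) (Fin n) ℝ)
    (q : (Fin k → ℝ) → ℝ) (P P' : Matrix (Fin k) (Fin k) ℝ) (Γ : Matrix (Fin n) (Fin k) ℝ) : Prop :=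
  ∀ u v, q u + (Aᵀ *ᵥ u) ⬝ᵥ P *ᵥ (Aᵀ *ᵥ u) - v ⬝ᵥ P *ᵥ v
      - Γ *ᵥ (Aᵀ *ᵥ u - v) ⬝ᵥ K *ᵥ (Γ *ᵥ (Aᵀ *ᵥ u - v)) ≤ u ⬝ᵥ P' *ᵥ u

/-- A matrix with simple real spectrum is diagonalisable. -/
lemma exists_diagonalization_of_injective {k : ℕ} {A : Matrix (Fin k) (Fin k) ℝ}
    {lam : Fin k → ℝ} (hinj : Function.Injective lam)
    (hA : A.charpoly = ∏ j, (Polynomial.X - Polynomial.C (lam j))) :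
    ∃ T : Matrix (Fin k) (Fin k) ℝ, IsUnit T.det ∧ A * T = T * Matrix.diagonal lam := by
  have hev : ∀ j, ∃ x : Fin k → ℝ, x ≠ 0 ∧ A *ᵥ x = lam j • x := by
    intro j
    have h1 : (lam j • (1 : Matrix (Fin k) (Fin k) ℝ) - A).det = 0 := by
      have := Matrix.eval_charpoly A (lam j)
      rw [hA, Polynomial.eval_prod, Finset.prod_eq_zero (Finset.mem_univ j) (by simp)] at this
      rw [this, Matrix.smul_one_eq_diagonal]
      rfl
    obtain ⟨x, hx, hx'⟩ := Matrix.exists_mulVec_eq_zero_iff.2 h1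
    refine ⟨x, hx, ?_⟩
    rw [Matrix.sub_mulVec, Matrix.smul_mulVec, Matrix.one_mulVec, sub_eq_zero] at hx'
    exact hx'.symm
  choose x hx0 hx using hev
  have hli : LinearIndependent ℝ x := by
    refine Module.End.eigenvectors_linearIndependent' (Matrix.toLin' A) lam hinj x fun j => ?_
    refine ⟨Module.End.mem_eigenspace_iff.2 ?_, hx0 j⟩
    rw [Matrix.toLin'_apply, hx]
  refine ⟨(Matrix.of x)ᵀ, ?_, ?_⟩
  · rw [Matrix.det_transpose, ← Matrix.isUnit_iff_isUnit_det, ← Matrix.linearIndependent_rows_iff_isUnit]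
    exact hli
  · ext i j
    rw [Matrix.mul_diagonal]
    have := congrFun (hx j) i
    simpa [Matrix.mul_apply, Matrix.mulVec, dotProduct, mul_comm] using this

/-- A strict approximate fixed point of the Riccati recursion yields an admissible triple, with a
fraction `η` of the power to spare. -/
lemma exists_lyapunovTrace_le_of_riccatiBound {k n : ℕ} {A : Matrix (Fin k) (Fin k) ℝ}
    {lam : Fin k → ℝ} (hinj : Function.Injective lam) (hlam : ∀ j, 1 < |lam j|)
    (hA : A.charpoly = ∏ j, (Polynomial.X - Polynomial.C (lam j)))
    {K : Matrix (Fin n) (Fin n) ℝ} (hKh : K.IsHermitian) {h : Fin n → ℝ}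
    (hK : K.charpoly = ∏ i, (Polynomial.X - Polynomial.C (h i ^ 2)))
    {q : (Fin k → ℝ) → ℝ} {κ d η : ℝ} (hκ : ∀ u, κ * ((Aᵀ *ᵥ u) ⬝ᵥ (Aᵀ *ᵥ u)) ≤ q u)
    (hη0 : 0 ≤ η) (hη1 : η < 1) (hη : η / (1 - η) * d < κ)
    {P : Matrix (Fin k) (Fin k) ℝ} (hP : P.PosDef) (hPd : P.trace ≤ d)
    {Γ : Matrix (Fin n) (Fin k) ℝ} (hR : RiccatiBound A K q P P Γ) :
    ∃ x ∈ allLyapunovTraces (fun j => (lam j)⁻¹) h, x ≤ (1 - η) * (Γ * P⁻¹ * Γᵀ).trace := by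
  obtain ⟨T, hT, hAT⟩ := exists_diagonalization_of_injective hinj hA
  obtain ⟨U, hU1, hU2, hKU⟩ := exists_orthogonal_diagonalization hKh _ hK
  have hlam0 : ∀ j, lam j ≠ 0 := fun j h0 => by
    have := hlam j
    rw [h0] at this
    norm_num at this
  have hTi : T * T⁻¹ = 1 := Matrix.mul_nonsing_inv _ hT
  have hTi' : T⁻¹ * T = 1 := Matrix.nonsing_inv_mul _ hT
  -- The columns of `s` are eigenvectors of `Aᵀ`, so `Aᵀ` undoes multiplication of the modal
  -- coordinates by `b = 1 / λ`.
  set s : Matrix (Fin k) (Fin k) ℝ := (T⁻¹)ᵀ with hs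
  set b : Fin k → ℝ := fun j => (lam j)⁻¹ with hb
  have hb1 : ∀ j, |b j| < 1 := fun j => by
    rw [hb, abs_inv]
    exact inv_lt_one_of_one_lt₀ (hlam j)
  have hAs : ∀ u : Fin k → ℝ, Aᵀ *ᵥ (s *ᵥ (b * u)) = s *ᵥ u := by
    intro u
    have h1 : T⁻¹ * A = Matrix.diagonal lam * T⁻¹ := by
      calc T⁻¹ * A = T⁻¹ * (A * T) * T⁻¹ := by
            rw [Matrix.mul_assoc, Matrix.mul_assoc, hTi, Matrix.mul_one]
        _ = Matrix.diagonal lam * T⁻¹ := by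
            rw [hAT, ← Matrix.mul_assoc, hTi', Matrix.one_mul]
    have h2 : Aᵀ * s = s * Matrix.diagonal lam := by
      rw [hs, ← Matrix.transpose_mul, h1, Matrix.transpose_mul, Matrix.diagonal_transpose]
    rw [Matrix.mulVec_mulVec, h2, ← Matrix.mulVec_mulVec]
    congr 1
    ext j
    rw [Matrix.mulVec_diagonal, Pi.mul_apply, hb, mul_inv_cancel_left₀ (hlam0 j)]
  have hsinj : Function.Injective (fun u => s *ᵥ u) := by
    intro u v huv
    have h1 := congrArg (fun y => Tᵀ *ᵥ y) huv
    simpa only [Matrix.mulVec_mulVec, hs, ← Matrix.transpose_mul, hTi', Matrix.transpose_one,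
      Matrix.one_mulVec] using h1
  have hPq : ∀ u : Fin k → ℝ, u ⬝ᵥ (T⁻¹ * P * s) *ᵥ u = (s *ᵥ u) ⬝ᵥ P *ᵥ (s *ᵥ u) := by
    intro u
    have h1 := dotProduct_transpose_mulVec s u (P *ᵥ (s *ᵥ u))
    rw [hs, Matrix.transpose_transpose] at h1
    rw [← Matrix.mulVec_mulVec, ← Matrix.mulVec_mulVec, h1]
  have hP' : (T⁻¹ * P * s).PosDef := by
    refine Matrix.PosDef.of_dotProduct_mulVec_pos ?_ fun u hu => ?_
    · simpa [hs] using Matrix.isHermitian_mul_mul_conjTranspose T⁻¹ hP.1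
    · rw [star_trivial, hPq]
      have h0 : s *ᵥ u ≠ 0 := fun h0 => hu (hsinj (by simpa using h0))
      simpa using hP.dotProduct_mulVec_pos h0
  have hinv : (T⁻¹ * P * s)⁻¹ = Tᵀ * P⁻¹ * T := by
    refine Matrix.inv_eq_left_inv ?_
    have h1 : P⁻¹ * P = 1 := Matrix.nonsing_inv_mul _ hP.det_pos.ne'.isUnit
    calc Tᵀ * P⁻¹ * T * (T⁻¹ * P * s) = Tᵀ * (P⁻¹ * ((T * T⁻¹) * P)) * s := by
          simp only [Matrix.mul_assoc]
      _ = 1 := by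
          rw [hTi, Matrix.one_mul, h1, Matrix.mul_one, hs, ← Matrix.transpose_mul, hTi',
            Matrix.transpose_one]
  have htr : ((Uᵀ * Γ * s) * (T⁻¹ * P * s)⁻¹ * (Uᵀ * Γ * s)ᵀ).trace = (Γ * P⁻¹ * Γᵀ).trace := by
    have h1 : s * Tᵀ = 1 := by rw [hs, ← Matrix.transpose_mul, hTi, Matrix.transpose_one]
    have h2 : (Uᵀ * Γ * s) * (T⁻¹ * P * s)⁻¹ * (Uᵀ * Γ * s)ᵀ = Uᵀ * (Γ * P⁻¹ * Γᵀ * U) := by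
      rw [hinv]
      calc (Uᵀ * Γ * s) * (Tᵀ * P⁻¹ * T) * (Uᵀ * Γ * s)ᵀ
          = Uᵀ * (Γ * (s * Tᵀ) * P⁻¹ * (T * T⁻¹) * Γᵀ * U) := by
            simp only [Matrix.transpose_mul, Matrix.transpose_transpose, Matrix.mul_assoc, hs]
        _ = _ := by rw [h1, hTi, Matrix.mul_one, Matrix.mul_one]
    rw [h2, Matrix.trace_mul_comm, Matrix.mul_assoc, hU2, Matrix.mul_one]
  rw [← htr]
  refine exists_lyapunovTrace_le hb1 h hP' (Uᵀ * Γ * s) hη0 hη1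
    (fun u => q (s *ᵥ (b * u))) (fun u hu => ?_) fun u v => ?_
  · have h1 := hκ (s *ᵥ (b * u))
    rw [hAs] at h1
    have h2 := dotProduct_mulVec_le_trace hP.posSemidef (s *ᵥ u)
    have h0 : s *ᵥ u ≠ 0 := fun h0 => hu (hsinj (by simpa using h0))
    have h3 : 0 < (s *ᵥ u) ⬝ᵥ (s *ᵥ u) := by
      simpa using (Matrix.dotProduct_star_self_pos_iff (v := s *ᵥ u)).2 h0
    have h4 : 0 ≤ η / (1 - η) := div_nonneg hη0 (by linarith)
    rw [hPq]
    calc η / (1 - η) * ((s *ᵥ u) ⬝ᵥ P *ᵥ (s *ᵥ u))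
        ≤ η / (1 - η) * (d * ((s *ᵥ u) ⬝ᵥ (s *ᵥ u))) := by
          refine mul_le_mul_of_nonneg_left (h2.trans ?_) h4
          exact mul_le_mul_of_nonneg_right hPd h3.le
      _ < κ * ((s *ᵥ u) ⬝ᵥ (s *ᵥ u)) := by
          rw [← mul_assoc]
          exact mul_lt_mul_of_pos_right hη h3
      _ ≤ _ := h1
  · have h1 := hR (s *ᵥ (b * u)) (s *ᵥ v)
    rw [hAs, ← Matrix.mulVec_sub] at h1
    have h2 : (Matrix.diagonal h * (Uᵀ * Γ * s)) *ᵥ (u - v)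
          ⬝ᵥ (Matrix.diagonal h * (Uᵀ * Γ * s)) *ᵥ (u - v)
        = Γ *ᵥ (s *ᵥ (u - v)) ⬝ᵥ K *ᵥ (Γ *ᵥ (s *ᵥ (u - v))) := by
      -- A square root of `K`: after rotating the input by `Uᵀ`, the channel acts as parallel gains
      -- `h i`.
      have hK' : K = (Matrix.diagonal h * Uᵀ)ᵀ * (Matrix.diagonal h * Uᵀ) := by
        rw [hKU, Matrix.transpose_mul, Matrix.diagonal_transpose, Matrix.transpose_transpose,
          Matrix.mul_assoc, Matrix.mul_assoc, ← Matrix.mul_assoc (Matrix.diagonal h),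
          Matrix.diagonal_mul_diagonal]
        simp only [pow_two]
      rw [hK', ← Matrix.mulVec_mulVec _ (Matrix.diagonal h * Uᵀ)ᵀ, dotProduct_transpose_mulVec]
      simp only [Matrix.mulVec_mulVec, Matrix.mul_assoc]
    rw [h2, hPq, hPq, hPq]
    exact h1

/-! ### From time averages to approximate fixed points -/

lemma sum_Icc_succ_eq (f : ℕ → ℝ) (T : ℕ) :
    ∑ t ∈ Finset.Icc 1 T, f (t + 1) = ∑ t ∈ Finset.Icc 1 T, f t + f (T + 1) - f 1 := by
  induction T with
  | zero => simp
  | succ T ih =>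
    rw [Finset.sum_Icc_succ_top (by omega), Finset.sum_Icc_succ_top (by omega), ih]
    ring

/-- A nonnegative sequence with bounded averages has `f (T + 1) ≤ δ T` for some large `T`. -/
lemma frequently_le_mul_of_sum_le {f : ℕ → ℝ} (hf : ∀ t, 1 ≤ t → 0 ≤ f t) {D δ : ℝ} (hδ : 0 < δ)
    (h : ∀ᶠ T : ℕ in atTop, ∑ t ∈ Finset.Icc 1 T, f t ≤ D * T) :
    ∃ᶠ T : ℕ in atTop, f (T + 1) ≤ δ * T := by
  intro hcon
  obtain ⟨T₀, hT₀⟩ := eventually_atTop.1 (h.and hcon)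
  obtain ⟨T₁, hT₁⟩ := exists_nat_gt (2 * D / δ)
  set T := max (max T₀ T₁) 1 with hT
  have h1 := (hT₀ (2 * T) (by omega)).1
  -- If `f (t + 1) > δ t` from some time on, the terms between `T + 1` and `2 T` add up to at least
  -- `δ T²`, beyond the linear bound `2 D T`.
  have h2 : ∑ t ∈ Finset.Icc (T + 1) (2 * T), δ * T ≤ ∑ t ∈ Finset.Icc 1 (2 * T), f t := by
    calc ∑ t ∈ Finset.Icc (T + 1) (2 * T), δ * T ≤ ∑ t ∈ Finset.Icc (T + 1) (2 * T), f t := by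
          refine Finset.sum_le_sum fun t ht => ?_
          have ht' := (Finset.mem_Icc.1 ht).1
          obtain ⟨s, rfl⟩ : ∃ s, t = s + 1 := ⟨t - 1, by omega⟩
          have h3 := (hT₀ s (by omega)).2
          push Not at h3
          have h4 : (T : ℝ) ≤ s := by exact_mod_cast (by omega : T ≤ s)
          nlinarith
      _ ≤ _ := by
          refine Finset.sum_le_sum_of_subset_of_nonneg
            (Finset.Icc_subset_Icc (by omega) le_rfl) fun t ht _ => hf t (Finset.mem_Icc.1 ht).1
  rw [Finset.sum_const, Nat.card_Icc, nsmul_eq_mul,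
    show 2 * T + 1 - (T + 1) = T by omega] at h2
  push_cast at h1
  have hTpos : (0 : ℝ) < T := by exact_mod_cast (by omega : 0 < T)
  have hTT : (T₁ : ℝ) ≤ T := by exact_mod_cast (by omega : T₁ ≤ T)
  rw [div_lt_iff₀ hδ] at hT₁
  have h5 : 2 * D < T * δ := hT₁.trans_le (mul_le_mul_of_nonneg_right hTT hδ.le)
  nlinarith [mul_lt_mul_of_pos_left h5 hTpos]

/-- A lower bound for the tail of a nonnegative sequence bounds its averages from below. -/
lemma le_of_sum_le {f : ℕ → ℝ} (hf : ∀ t, 1 ≤ t → 0 ≤ f t) {D x : ℝ} (s : ℕ)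
    (hx : ∀ t, s < t → x ≤ f t)
    (h : ∀ᶠ T : ℕ in atTop, ∑ t ∈ Finset.Icc 1 T, f t ≤ D * T) : x ≤ D := by
  by_contra! hcon
  obtain ⟨T₀, hT₀⟩ := eventually_atTop.1 h
  -- Beyond this time `x (T - s) > D T`.
  obtain ⟨T₁, hT₁⟩ := exists_nat_gt (x * s / (x - D))
  set T := max (max T₀ T₁) s with hT
  have h1 := hT₀ T (by omega)
  have h2 : ∑ t ∈ Finset.Icc (s + 1) T, x ≤ ∑ t ∈ Finset.Icc 1 T, f t := by
    calc ∑ t ∈ Finset.Icc (s + 1) T, x ≤ ∑ t ∈ Finset.Icc (s + 1) T, f t :=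
          Finset.sum_le_sum fun t ht => hx t (Finset.mem_Icc.1 ht).1
      _ ≤ _ := Finset.sum_le_sum_of_subset_of_nonneg
            (Finset.Icc_subset_Icc (by omega) le_rfl) fun t ht _ => hf t (Finset.mem_Icc.1 ht).1
  rw [Finset.sum_const, Nat.card_Icc, nsmul_eq_mul,
    show T + 1 - (s + 1) = T - s by omega, Nat.cast_sub (by omega)] at h2
  have hTT : (T₁ : ℝ) ≤ T := by exact_mod_cast (by omega : T₁ ≤ T)
  rw [div_lt_iff₀ (by linarith)] at hT₁
  nlinarith

lemma dotProduct_sum_mulVec {k : ℕ} {ι : Type*} (s : Finset ι) (P : ι → Matrix (Fin k) (Fin k) ℝ)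
    (x : Fin k → ℝ) : x ⬝ᵥ (∑ i ∈ s, P i) *ᵥ x = ∑ i ∈ s, x ⬝ᵥ P i *ᵥ x := by
  rw [Matrix.sum_mulVec, dotProduct_sum]

/-- The gain `L = Γ P⁻¹` attains equality in the family of lower bounds that defines the power cost.
-/
lemma trace_mul_inv_mul_eq {k n : ℕ} {P : Matrix (Fin k) (Fin k) ℝ} (hP : P.PosDef)
    (Γ : Matrix (Fin n) (Fin k) ℝ) :
    2 * ((Γ * P⁻¹) * Γᵀ).trace - ((Γ * P⁻¹) * P * (Γ * P⁻¹)ᵀ).trace = (Γ * P⁻¹ * Γᵀ).trace := by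
  have h1 : (Γ * P⁻¹) * P * (Γ * P⁻¹)ᵀ = Γ * P⁻¹ * Γᵀ := by
    have hPT : (P⁻¹)ᵀ = P⁻¹ := by simpa using hP.inv.1.eq
    rw [Matrix.transpose_mul, hPT, Matrix.mul_assoc Γ,
      Matrix.nonsing_inv_mul _ hP.det_pos.ne'.isUnit, Matrix.mul_one, Matrix.mul_assoc]
  rw [h1]
  ring

/-- If the covariance of input and innovation is constant in time, averaging the error covariances
gives approximate fixed points of the Riccati recursion. -/
lemma exists_riccatiBound_of_const_crossCov {k n : ℕ} {A : Matrix (Fin k) (Fin k) ℝ}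
    {K : Matrix (Fin n) (Fin n) ℝ} {q : (Fin k → ℝ) → ℝ} {κ : ℝ} (hκ : 0 < κ)
    {P : ℕ → Matrix (Fin k) (Fin k) ℝ} (hP : ∀ t, 1 ≤ t → (P t).PosDef)
    {Γ : Matrix (Fin n) (Fin k) ℝ} {ν : ℕ → ℝ}
    (hR : ∀ t, 1 ≤ t → RiccatiBound A K q (P t) (P (t + 1)) Γ)
    (hν : ∀ t, 1 ≤ t → ∀ L : Matrix (Fin n) (Fin k) ℝ,
      2 * (L * Γᵀ).trace - (L * P t * Lᵀ).trace ≤ ν t)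
    {D p : ℝ} (hD : ∀ᶠ T : ℕ in atTop, ∑ t ∈ Finset.Icc 1 T, (P t).trace ≤ D * T)
    (hp : ∀ᶠ T : ℕ in atTop, ∑ t ∈ Finset.Icc 1 T, ν t ≤ p * T) :
    ∃ (P' : Matrix (Fin k) (Fin k) ℝ) (Γ' : Matrix (Fin n) (Fin k) ℝ), P'.PosDef ∧
      P'.trace ≤ D ∧ (Γ' * P'⁻¹ * Γ'ᵀ).trace ≤ p ∧
      RiccatiBound A K (fun u => q u - κ / 2 * (u ⬝ᵥ u)) P' P' Γ' := by
  -- Summing the recursion telescopes up to the boundary term `P (T + 1) / T`; this horizon makes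
  -- its trace at most `κ / 2`.
  obtain ⟨T, hT, hTD, hTp, hT1⟩ := ((frequently_le_mul_of_sum_le
    (fun t ht => (hP t ht).posSemidef.trace_nonneg) (half_pos hκ) hD).and_eventually
    (hD.and (hp.and (eventually_ge_atTop 1)))).exists
  have hT0 : (0 : ℝ) < T := by exact_mod_cast hT1
  have hTi : (0 : ℝ) < (T : ℝ)⁻¹ := inv_pos.2 hT0
  set S := ∑ t ∈ Finset.Icc 1 T, P t with hS
  have hSpd : S.PosDef := Matrix.posDef_sum ⟨1, Finset.mem_Icc.2 ⟨le_rfl, hT1⟩⟩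
    fun t ht => hP t (Finset.mem_Icc.1 ht).1
  have hcard : ((Finset.Icc 1 T).card : ℝ) = T := by simp
  have hquad : ∀ x, x ⬝ᵥ ((T : ℝ)⁻¹ • S) *ᵥ x = (T : ℝ)⁻¹ * ∑ t ∈ Finset.Icc 1 T, x ⬝ᵥ P t *ᵥ x := by
    intro x
    rw [Matrix.smul_mulVec, dotProduct_smul, hS, dotProduct_sum_mulVec, smul_eq_mul]
  have hpd : ((T : ℝ)⁻¹ • S).PosDef := hSpd.smul hTi
  refine ⟨(T : ℝ)⁻¹ • S, Γ, hpd, ?_, ?_, fun u v => ?_⟩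
  · rw [Matrix.trace_smul, hS, Matrix.trace_sum, smul_eq_mul, inv_mul_le_iff₀ hT0]
    linarith
  · rw [← trace_mul_inv_mul_eq hpd]
    -- One gain, optimal for the averaged covariance, is used at every time; this is Jensen's
    -- inequality for the power cost.
    set L := Γ * ((T : ℝ)⁻¹ • S)⁻¹
    have h1 : (L * ((T : ℝ)⁻¹ • S) * Lᵀ).trace
        = (T : ℝ)⁻¹ * ∑ t ∈ Finset.Icc 1 T, (L * P t * Lᵀ).trace := by
      rw [Matrix.mul_smul, Matrix.smul_mul, Matrix.trace_smul, hS, Matrix.mul_sum, Matrix.sum_mul,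
        Matrix.trace_sum, smul_eq_mul]
    have h2 := Finset.sum_le_sum fun t (ht : t ∈ Finset.Icc 1 T) =>
      hν t (Finset.mem_Icc.1 ht).1 L
    rw [Finset.sum_sub_distrib, Finset.sum_const, nsmul_eq_mul, hcard] at h2
    rw [h1]
    have h3 := mul_le_mul_of_nonneg_left (h2.trans hTp) hTi.le
    rw [mul_sub, inv_mul_cancel_left₀ hT0.ne', mul_comm p, inv_mul_cancel_left₀ hT0.ne'] at h3
    exact h3
  · simp only [hquad]
    have h1 := Finset.sum_le_sum fun t (ht : t ∈ Finset.Icc 1 T) =>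
      hR t (Finset.mem_Icc.1 ht).1 u v
    rw [sum_Icc_succ_eq (fun t => u ⬝ᵥ P t *ᵥ u)] at h1
    simp only [Finset.sum_sub_distrib, Finset.sum_add_distrib, Finset.sum_const, nsmul_eq_mul,
      hcard] at h1
    have h2 : u ⬝ᵥ P (T + 1) *ᵥ u ≤ κ / 2 * T * (u ⬝ᵥ u) :=
      (dotProduct_mulVec_le_trace (hP _ (by omega)).posSemidef u).trans
        (mul_le_mul_of_nonneg_right hT (dotProduct_self_nonneg' u))
    have h3 : 0 ≤ u ⬝ᵥ P 1 *ᵥ u := by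
      simpa using (hP 1 le_rfl).posSemidef.dotProduct_mulVec_nonneg u
    have h4 : (T : ℝ) * (q u - κ / 2 * (u ⬝ᵥ u)
        + (T : ℝ)⁻¹ * ∑ t ∈ Finset.Icc 1 T, (Aᵀ *ᵥ u) ⬝ᵥ P t *ᵥ (Aᵀ *ᵥ u)
        - (T : ℝ)⁻¹ * ∑ t ∈ Finset.Icc 1 T, v ⬝ᵥ P t *ᵥ v
        - Γ *ᵥ (Aᵀ *ᵥ u - v) ⬝ᵥ K *ᵥ (Γ *ᵥ (Aᵀ *ᵥ u - v)))
        ≤ T * ((T : ℝ)⁻¹ * ∑ t ∈ Finset.Icc 1 T, u ⬝ᵥ P t *ᵥ u) := by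
      rw [mul_inv_cancel_left₀ hT0.ne', mul_sub, mul_sub, mul_add,
        mul_inv_cancel_left₀ hT0.ne', mul_inv_cancel_left₀ hT0.ne']
      linarith
    exact le_of_mul_le_mul_left h4 hT0

/-! ### Constant gain: monotone Riccati iteration -/

/-- The Riccati recursion with a constant gain `G`. -/
noncomputable def riccatiIterate {k : ℕ} (A Q F : Matrix (Fin k) (Fin k) ℝ) :
    ℕ → Matrix (Fin k) (Fin k) ℝ
  | 0 => Q
  | s + 1 => A * ((riccatiIterate A Q F s)⁻¹ + F)⁻¹ * Aᵀ + Q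

lemma riccatiIterate_succ_quadratic {k : ℕ} (A Q F : Matrix (Fin k) (Fin k) ℝ) (s : ℕ)
    (u : Fin k → ℝ) : u ⬝ᵥ riccatiIterate A Q F (s + 1) *ᵥ u
      = (Aᵀ *ᵥ u) ⬝ᵥ ((riccatiIterate A Q F s)⁻¹ + F)⁻¹ *ᵥ (Aᵀ *ᵥ u) + u ⬝ᵥ Q *ᵥ u := by
  have h1 := dotProduct_transpose_mulVec Aᵀ u (((riccatiIterate A Q F s)⁻¹ + F)⁻¹ *ᵥ (Aᵀ *ᵥ u))
  rw [Matrix.transpose_transpose] at h1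
  rw [riccatiIterate, Matrix.add_mulVec, dotProduct_add, ← Matrix.mulVec_mulVec,
    ← Matrix.mulVec_mulVec, h1]

lemma riccatiIterate_posDef {k : ℕ} (A : Matrix (Fin k) (Fin k) ℝ) {Q F : Matrix (Fin k) (Fin k) ℝ}
    (hQ : Q.PosDef) (hF : F.PosSemidef) (s : ℕ) : (riccatiIterate A Q F s).PosDef := by
  induction s with
  | zero => exact hQ
  | succ s ih =>
    have h1 := (ih.inv.add_posSemidef hF).inv.posSemidef.mul_mul_conjTranspose_same A
    exact Matrix.PosDef.posSemidef_add (by simpa using h1) hQ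

/-- Two order-reversing inversions with an addition in between: the posterior covariance increases
with the prior one. -/
lemma Matrix.PosDef.inv_add_inv_mono {k : ℕ} {M N F : Matrix (Fin k) (Fin k) ℝ} (hM : M.PosDef)
    (hN : N.PosDef) (hF : F.PosSemidef) (h : ∀ u, u ⬝ᵥ M *ᵥ u ≤ u ⬝ᵥ N *ᵥ u) (w : Fin k → ℝ) :
    w ⬝ᵥ (M⁻¹ + F)⁻¹ *ᵥ w ≤ w ⬝ᵥ (N⁻¹ + F)⁻¹ *ᵥ w := by
  refine Matrix.PosDef.inv_antitone (hN.inv.add_posSemidef hF) (hM.inv.add_posSemidef hF)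
    (fun y => ?_) w
  rw [Matrix.add_mulVec, Matrix.add_mulVec, dotProduct_add, dotProduct_add]
  linarith [hM.inv_antitone hN h y]

lemma riccatiIterate_mono {k : ℕ} (A : Matrix (Fin k) (Fin k) ℝ) {Q F : Matrix (Fin k) (Fin k) ℝ}
    (hQ : Q.PosDef) (hF : F.PosSemidef) (s : ℕ) (u : Fin k → ℝ) :
    u ⬝ᵥ riccatiIterate A Q F s *ᵥ u ≤ u ⬝ᵥ riccatiIterate A Q F (s + 1) *ᵥ u := by
  have hpd := riccatiIterate_posDef A hQ hF
  induction s generalizing u with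
  | zero =>
    rw [riccatiIterate_succ_quadratic]
    have := ((hpd 0).inv.add_posSemidef hF).inv.posSemidef.dotProduct_mulVec_nonneg (Aᵀ *ᵥ u)
    rw [star_trivial] at this
    exact le_add_of_nonneg_left this
  | succ s ih =>
    rw [riccatiIterate_succ_quadratic, riccatiIterate_succ_quadratic]
    have := (hpd s).inv_add_inv_mono (hpd (s + 1)) hF ih (Aᵀ *ᵥ u)
    linarith

/-- The substitution `y = P (w - v)` turns the Riccati expression into `2 w·y` minus a quadratic
form in `y`. Hence its supremum over `v` is the posterior covariance in information form, `(P⁻¹ + Gᵀ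
K G)⁻¹`. -/
lemma gain_quadratic_eq {k n : ℕ} {P : Matrix (Fin k) (Fin k) ℝ} (hP : P.PosDef)
    (G : Matrix (Fin n) (Fin k) ℝ) (K : Matrix (Fin n) (Fin n) ℝ) (w v : Fin k → ℝ) :
    w ⬝ᵥ P *ᵥ w - v ⬝ᵥ P *ᵥ v - (G * P) *ᵥ (w - v) ⬝ᵥ K *ᵥ ((G * P) *ᵥ (w - v))
      = 2 * (w ⬝ᵥ P *ᵥ (w - v))
        - (P *ᵥ (w - v)) ⬝ᵥ (P⁻¹ + Gᵀ * K * G) *ᵥ (P *ᵥ (w - v)) := by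
  set x := w - v with hx
  have h1 : v ⬝ᵥ P *ᵥ v = w ⬝ᵥ P *ᵥ w - 2 * (w ⬝ᵥ P *ᵥ x) + x ⬝ᵥ P *ᵥ x := by
    rw [← dotProduct_mulVec_sub_self hP.1, hx, sub_sub_cancel]
  have h2 : P⁻¹ *ᵥ (P *ᵥ x) = x := by
    rw [Matrix.mulVec_mulVec, Matrix.nonsing_inv_mul _ hP.det_pos.ne'.isUnit, Matrix.one_mulVec]
  have h3 : (P *ᵥ x) ⬝ᵥ (Gᵀ * K * G) *ᵥ (P *ᵥ x)
      = (G * P) *ᵥ x ⬝ᵥ K *ᵥ ((G * P) *ᵥ x) := by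
    rw [← Matrix.mulVec_mulVec, ← Matrix.mulVec_mulVec, dotProduct_transpose_mulVec,
      Matrix.mulVec_mulVec x G P]
  rw [Matrix.add_mulVec, dotProduct_add, h2, h3, h1, dotProduct_comm (P *ᵥ x) x]
  ring

lemma RiccatiBound.le_of_gain {k n : ℕ} {A P P' : Matrix (Fin k) (Fin k) ℝ} (hP : P.PosDef)
    {G : Matrix (Fin n) (Fin k) ℝ} {K : Matrix (Fin n) (Fin n) ℝ} (hK : K.PosSemidef)
    {q : (Fin k → ℝ) → ℝ} (hR : RiccatiBound A K q P P' (G * P)) (u : Fin k → ℝ) :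
    q u + (Aᵀ *ᵥ u) ⬝ᵥ (P⁻¹ + Gᵀ * K * G)⁻¹ *ᵥ (Aᵀ *ᵥ u) ≤ u ⬝ᵥ P' *ᵥ u := by
  have hF : (Gᵀ * K * G).PosSemidef := by simpa using hK.conjTranspose_mul_mul_same G
  set w := Aᵀ *ᵥ u with hw
  set y := (P⁻¹ + Gᵀ * K * G)⁻¹ *ᵥ w with hy
  -- This `v` corresponds to the maximiser `y`, where the variational bound is an equality.
  have h1 := hR u (w - P⁻¹ *ᵥ y)
  have h2 := gain_quadratic_eq hP G K w (w - P⁻¹ *ᵥ y)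
  rw [← hw] at h1
  rw [sub_sub_cancel, hP.mulVec_inv] at h2
  rw [sub_sub_cancel] at h1
  have h3 := (hP.inv.add_posSemidef hF).inv_quadratic_eq w
  rw [← hy] at h3
  linarith

lemma RiccatiBound.of_gain {k n : ℕ} {A P P' : Matrix (Fin k) (Fin k) ℝ} (hP : P.PosDef)
    {G : Matrix (Fin n) (Fin k) ℝ} {K : Matrix (Fin n) (Fin n) ℝ} (hK : K.PosSemidef)
    {q : (Fin k → ℝ) → ℝ}
    (h : ∀ u, q u + (Aᵀ *ᵥ u) ⬝ᵥ (P⁻¹ + Gᵀ * K * G)⁻¹ *ᵥ (Aᵀ *ᵥ u) ≤ u ⬝ᵥ P' *ᵥ u) :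
    RiccatiBound A K q P P' (G * P) := by
  intro u v
  have hF : (Gᵀ * K * G).PosSemidef := by simpa using hK.conjTranspose_mul_mul_same G
  have h1 := gain_quadratic_eq hP G K (Aᵀ *ᵥ u) v
  have h2 := (hP.inv.add_posSemidef hF).le_inv_quadratic (Aᵀ *ᵥ u) (P *ᵥ (Aᵀ *ᵥ u - v))
  linarith [h u]

lemma trace_le_of_forall_quadratic_le {k : ℕ} {M N : Matrix (Fin k) (Fin k) ℝ}
    (h : ∀ u, u ⬝ᵥ M *ᵥ u ≤ u ⬝ᵥ N *ᵥ u) : M.trace ≤ N.trace := by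
  refine Finset.sum_le_sum fun i _ => ?_
  simpa using h (Pi.single i 1)

lemma trace_conj_le_of_forall_quadratic_le {k n : ℕ} {M N : Matrix (Fin k) (Fin k) ℝ}
    (h : ∀ u, u ⬝ᵥ M *ᵥ u ≤ u ⬝ᵥ N *ᵥ u) (G : Matrix (Fin n) (Fin k) ℝ) :
    (G * M * Gᵀ).trace ≤ (G * N * Gᵀ).trace := by
  refine trace_le_of_forall_quadratic_le fun u => ?_
  have h1 : ∀ M : Matrix (Fin k) (Fin k) ℝ,
      u ⬝ᵥ (G * M * Gᵀ) *ᵥ u = (Gᵀ *ᵥ u) ⬝ᵥ M *ᵥ (Gᵀ *ᵥ u) := by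
    intro M
    have := dotProduct_transpose_mulVec Gᵀ u (M *ᵥ (Gᵀ *ᵥ u))
    rw [Matrix.transpose_transpose] at this
    rw [← Matrix.mulVec_mulVec, ← Matrix.mulVec_mulVec, this]
  rw [h1, h1]
  exact h _

/-- If the encoder gain is constant in time, the monotone Riccati iterates that start from the noise
covariance give approximate fixed points of the Riccati recursion. -/
lemma exists_riccatiBound_of_const_gain {k n : ℕ} {A Q : Matrix (Fin k) (Fin k) ℝ} (hQ : Q.PosDef)
    {K : Matrix (Fin n) (Fin n) ℝ} (hK : K.PosSemidef) {κ : ℝ} (hκ : 0 < κ)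
    {P : ℕ → Matrix (Fin k) (Fin k) ℝ} (hP : ∀ t, 1 ≤ t → (P t).PosDef)
    (hPQ : ∀ u, u ⬝ᵥ Q *ᵥ u ≤ u ⬝ᵥ P 1 *ᵥ u)
    {G : Matrix (Fin n) (Fin k) ℝ} {ν : ℕ → ℝ}
    (hR : ∀ t, 1 ≤ t → RiccatiBound A K (fun u => u ⬝ᵥ Q *ᵥ u) (P t) (P (t + 1)) (G * P t))
    (hν : ∀ t, 1 ≤ t → ∀ L : Matrix (Fin n) (Fin k) ℝ,
      2 * (L * (G * P t)ᵀ).trace - (L * P t * Lᵀ).trace ≤ ν t)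
    {D p : ℝ} (hD : ∀ᶠ T : ℕ in atTop, ∑ t ∈ Finset.Icc 1 T, (P t).trace ≤ D * T)
    (hp : ∀ᶠ T : ℕ in atTop, ∑ t ∈ Finset.Icc 1 T, ν t ≤ p * T) :
    ∃ (P' : Matrix (Fin k) (Fin k) ℝ) (Γ' : Matrix (Fin n) (Fin k) ℝ), P'.PosDef ∧
      P'.trace ≤ D ∧ (Γ' * P'⁻¹ * Γ'ᵀ).trace ≤ p ∧
      RiccatiBound A K (fun u => u ⬝ᵥ Q *ᵥ u - κ / 2 * (u ⬝ᵥ u)) P' P' Γ' := by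
  have hF : (Gᵀ * K * G).PosSemidef := by simpa using hK.conjTranspose_mul_mul_same G
  set R := riccatiIterate A Q (Gᵀ * K * G) with hRdef
  have hRpd : ∀ s, (R s).PosDef := riccatiIterate_posDef A hQ hF
  have hRmono : ∀ s u, u ⬝ᵥ R s *ᵥ u ≤ u ⬝ᵥ R (s + 1) *ᵥ u := riccatiIterate_mono A hQ hF
  have hRP : ∀ s u, u ⬝ᵥ R s *ᵥ u ≤ u ⬝ᵥ P (s + 1) *ᵥ u := by
    intro s
    induction s with
    | zero => exact hPQ
    | succ s ih =>
      intro u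
      have h1 := (hR (s + 1) (by omega)).le_of_gain (hP _ (by omega)) hK u
      have h2 := (hRpd s).inv_add_inv_mono (hP (s + 1) (by omega)) hF ih (Aᵀ *ᵥ u)
      have h3 := riccatiIterate_succ_quadratic A Q (Gᵀ * K * G) s u
      rw [← hRdef] at h3
      linarith
  have hRle : ∀ s t, s < t → ∀ u, u ⬝ᵥ R s *ᵥ u ≤ u ⬝ᵥ P t *ᵥ u := by
    intro s t hst u
    have h1 : u ⬝ᵥ R s *ᵥ u ≤ u ⬝ᵥ R (t - 1) *ᵥ u :=
      monotone_nat_of_le_succ (f := fun s => u ⬝ᵥ R s *ᵥ u) (fun s => hRmono s u) (by omega)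
    have h2 := hRP (t - 1) u
    rw [show t - 1 + 1 = t by omega] at h2
    exact h1.trans h2
  -- Each fixed iterate lies below all later error covariances, so any bound on their long-run
  -- averages bounds the iterate itself.
  have hRD : ∀ s, (R s).trace ≤ D := fun s =>
    le_of_sum_le (fun t ht => (hP t ht).posSemidef.trace_nonneg) s
      (fun t ht => trace_le_of_forall_quadratic_le (hRle s t ht)) hD
  have hGP : ∀ P : Matrix (Fin k) (Fin k) ℝ, P.PosDef → (G * P)ᵀ = P * Gᵀ := by
    intro P hP
    have : Pᵀ = P := by simpa using hP.1.eq
    rw [Matrix.transpose_mul, this]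
  have hRp : ∀ s, (G * R s * Gᵀ).trace ≤ p := by
    intro s
    refine le_of_sum_le (f := ν) (fun t ht => ?_) s (fun t ht => ?_) hp
    · simpa using hν t ht 0
    · have h1 := hν t (by omega) G
      rw [hGP _ (hP t (by omega)), ← Matrix.mul_assoc] at h1
      have h2 := trace_conj_le_of_forall_quadratic_le (hRle s t ht) G
      linarith
  -- The traces cannot grow by more than `κ / 2` at every step and remain at most `D`; a small
  -- increment of the trace bounds the increment of the whole form.
  obtain ⟨s, hs⟩ : ∃ s, (R (s + 1)).trace - (R s).trace ≤ κ / 2 := by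
    by_contra! hcon
    have h1 : ∀ s : ℕ, s * (κ / 2) ≤ (R s).trace := by
      intro s
      induction s with
      | zero => simpa using (hRpd 0).posSemidef.trace_nonneg
      | succ s ih =>
        push_cast
        linarith [hcon s]
    obtain ⟨s, hs⟩ := exists_nat_gt (D / (κ / 2))
    rw [div_lt_iff₀ (half_pos hκ)] at hs
    linarith [h1 s, hRD s]
  refine ⟨R s, G * R s, hRpd s, hRD s, ?_, RiccatiBound.of_gain (hRpd s) hK fun u => ?_⟩
  · rw [hGP _ (hRpd s), Matrix.mul_assoc G, Matrix.mul_nonsing_inv _ (hRpd s).det_pos.ne'.isUnit,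
      Matrix.mul_one, ← Matrix.mul_assoc]
    exact hRp s
  · have h1 : (R (s + 1) - R s).PosSemidef := by
      refine Matrix.PosSemidef.of_dotProduct_mulVec_nonneg ((hRpd _).1.sub (hRpd _).1) fun u => ?_
      rw [star_trivial, Matrix.sub_mulVec, dotProduct_sub]
      linarith [hRmono s u]
    have h2 := dotProduct_mulVec_le_trace h1 u
    rw [Matrix.trace_sub, Matrix.sub_mulVec, dotProduct_sub] at h2
    have h3 := mul_le_mul_of_nonneg_right hs (dotProduct_self_nonneg' u)
    have h4 := riccatiIterate_succ_quadratic A Q (Gᵀ * K * G) s u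
    rw [← hRdef] at h4
    linarith

/-! ### The allocation -/

lemma channelCapacity_mono (h : ℝ) {x y : ℝ} (hx : 0 ≤ x) (hxy : x ≤ y) :
    channelCapacity h x ≤ channelCapacity h y := by
  unfold channelCapacity
  gcongr

/-- A sparse admissible triple of power less than `p` yields a stabilizing allocation of power
`p`. -/
lemma LyapunovFeasible.exists_allocation {k n : ℕ} (hk : 0 < k) {lam : Fin k → ℝ} {h : Fin n → ℝ}
    (hlam : ∀ j, 1 < |lam j|)
    {Γ : Matrix (Fin n) (Fin k) ℝ} {Pw : Matrix (Fin n) (Fin n) ℝ} {J : Matrix (Fin k) (Fin k) ℝ}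
    (hf : LyapunovFeasible (fun j => (lam j)⁻¹) h Γ Pw J) (hΓ : ∀ j, ∃! i, Γ i j ≠ 0)
    {p : ℝ} (hp : Pw.trace < p) :
    ∃ (S : Fin n → Finset (Fin k)) (pw : Fin n → ℝ), IsStabilizingAllocation lam h p S pw := by
  have hn : (0 : ℝ) < n := by
    obtain ⟨i, -⟩ := (hΓ ⟨0, hk⟩).exists
    exact_mod_cast i.pos
  -- The spare power is split equally, so a channel of non-zero gain with no modes also gets
  -- strictly positive capacity.
  set e := (p - Pw.trace) / n with he
  have he0 : 0 < e := div_pos (by linarith) hn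
  have hPw : ∀ i, 0 ≤ Pw i i := fun i => hf.power_posSemidef.diag_nonneg
  refine ⟨fun i => Finset.univ.filter fun j => Γ i j ≠ 0, fun i => Pw i i + e, ?_, fun j => ?_,
    fun i => by linarith [hPw i], ?_, fun i => ?_⟩
  · intro i i' hii
    rw [Finset.disjoint_filter]
    exact fun j _ h1 h2 => hii ((hΓ j).unique h1 h2)
  · obtain ⟨i, hi⟩ := (hΓ j).exists
    exact ⟨i, by simpa using hi⟩
  · rw [Finset.sum_add_distrib, Finset.sum_const, Finset.card_univ, Fintype.card_fin,
      nsmul_eq_mul, he, mul_div_cancel₀ _ hn.ne']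
    simp [Matrix.trace]
  · rcases (Finset.univ.filter fun j => Γ i j ≠ 0).eq_empty_or_nonempty with hS | hS
    · by_cases hi : h i = 0
      · exact Or.inr ⟨hi, hS⟩
      · left
        rw [hS, Finset.sum_empty, channelCapacity]
        have : 0 < h i ^ 2 * (Pw i i + e) :=
          mul_pos (by positivity) (add_pos_of_nonneg_of_pos (hPw i) he0)
        have := Real.log_pos (x := 1 + h i ^ 2 * (Pw i i + e)) (by linarith)
        linarith
    · exact Or.inl ((hf.sum_log_lt hlam hΓ i hS).trans_le
        (channelCapacity_mono _ (hPw i) (by linarith)))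

/-- The power of a sparse admissible triple cannot be arbitrarily small. -/
lemma exists_pos_le_trace {k n : ℕ} (hk : 0 < k) {lam : Fin k → ℝ} {h : Fin n → ℝ}
    (hlam : ∀ j, 1 < |lam j|) {Γ : Matrix (Fin n) (Fin k) ℝ} (hΓ : ∀ j, ∃! i, Γ i j ≠ 0) :
    ∃ δ : ℝ, 0 < δ ∧ ∀ x ∈ lyapunovTraces (fun j => (lam j)⁻¹) h Γ, δ ≤ x := by
  obtain ⟨i, hi⟩ := (hΓ ⟨0, hk⟩).exists
  set L := Real.log |lam ⟨0, hk⟩| with hL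
  have hL0 : 0 < L := Real.log_pos (hlam _)
  -- The channel carrying the first mode needs `L < ½ log (1 + h² π) ≤ ½ h² π`, which bounds its
  -- power from below.
  refine ⟨2 * L / (h i ^ 2 + 1), by positivity, ?_⟩
  rintro x ⟨Pw, J, hf, rfl⟩
  have hPw : ∀ i, 0 ≤ Pw i i := fun i => hf.power_posSemidef.diag_nonneg
  have hmem : (⟨0, hk⟩ : Fin k) ∈ Finset.univ.filter fun j => Γ i j ≠ 0 := by simpa using hi
  have h1 := hf.sum_log_lt hlam hΓ i ⟨_, hmem⟩
  have h2 : L ≤ ∑ j ∈ Finset.univ.filter (fun j => Γ i j ≠ 0), Real.log |lam j| :=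
    Finset.single_le_sum (f := fun j => Real.log |lam j|)
      (fun j _ => (Real.log_pos (hlam j)).le) hmem
  have h3 : channelCapacity (h i) (Pw i i) ≤ 1 / 2 * (h i ^ 2 * Pw i i) := by
    unfold channelCapacity
    have h4 : 0 ≤ h i ^ 2 * Pw i i := mul_nonneg (sq_nonneg _) (hPw i)
    have := Real.log_le_sub_one_of_pos (x := 1 + h i ^ 2 * Pw i i) (by linarith)
    linarith
  have h4 : Pw i i ≤ Pw.trace :=
    Finset.single_le_sum (f := fun i => Pw i i) (fun i _ => hPw i) (Finset.mem_univ i)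
  rw [div_le_iff₀ (by positivity)]
  nlinarith [hPw i, sq_nonneg (h i), mul_le_mul_of_nonneg_left h4 (sq_nonneg (h i))]

/-- Approximate fixed points of the Riccati recursion of power close to `p` yield a stabilizing
allocation of power `p`. -/
lemma exists_allocation_of_riccatiBound {k n : ℕ} (hk : 0 < k) {A Q : Matrix (Fin k) (Fin k) ℝ}
    {lam : Fin k → ℝ} (hinj : Function.Injective lam) (hlam : ∀ j, 1 < |lam j|)
    (hA : A.charpoly = ∏ j, (Polynomial.X - Polynomial.C (lam j)))
    {K : Matrix (Fin n) (Fin n) ℝ} (hKh : K.IsHermitian) {h : Fin n → ℝ}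
    (hK : K.charpoly = ∏ i, (Polynomial.X - Polynomial.C (h i ^ 2))) {p : ℝ} (hp : 0 ≤ p)
    (hconj : LyapunovPositivity (fun j => (lam j)⁻¹) h) {κ D : ℝ} (hκ : 0 < κ)
    (hQ : ∀ u, κ * (u ⬝ᵥ u) ≤ u ⬝ᵥ Q *ᵥ u)
    (hR : ∀ ε : ℝ, 0 < ε → ∃ (P : Matrix (Fin k) (Fin k) ℝ) (Γ : Matrix (Fin n) (Fin k) ℝ),
      P.PosDef ∧ P.trace ≤ D ∧ (Γ * P⁻¹ * Γᵀ).trace ≤ p + ε ∧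
      RiccatiBound A K (fun u => u ⬝ᵥ Q *ᵥ u - κ / 2 * (u ⬝ᵥ u)) P P Γ) :
    ∃ (S : Fin n → Finset (Fin k)) (pw : Fin n → ℝ), IsStabilizingAllocation lam h p S pw := by
  have hAA : (A * Aᵀ).PosSemidef := by simpa using Matrix.posSemidef_self_mul_conjTranspose A
  have htr := hAA.trace_nonneg
  -- The slack left in `q` is expressed through `Aᵀ u`, the vector that becomes the modal variable.
  set κ' := κ / 2 / ((A * Aᵀ).trace + 1) with hκ'
  have hκ'0 : 0 < κ' := by positivity
  have hκ'q : ∀ u, κ' * ((Aᵀ *ᵥ u) ⬝ᵥ (Aᵀ *ᵥ u)) ≤ u ⬝ᵥ Q *ᵥ u - κ / 2 * (u ⬝ᵥ u) := by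
    intro u
    have h1 : (Aᵀ *ᵥ u) ⬝ᵥ (Aᵀ *ᵥ u) ≤ ((A * Aᵀ).trace + 1) * (u ⬝ᵥ u) := by
      have h2 := dotProduct_mulVec_le_trace hAA u
      have h3 := dotProduct_transpose_mulVec Aᵀ u (Aᵀ *ᵥ u)
      rw [Matrix.transpose_transpose, Matrix.mulVec_mulVec] at h3
      linarith [dotProduct_self_nonneg' u]
    have h4 := mul_le_mul_of_nonneg_left h1 hκ'0.le
    rw [← mul_assoc, hκ', div_mul_cancel₀ _ (by positivity)] at h4
    linarith [hQ u]
  -- Chosen so that `τ D < κ'`; `η` then solves `η / (1 - η) = τ` and does not depend on `ε`.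
  set τ := κ' / (2 * (|D| + 1)) with hτ
  have hτ0 : 0 < τ := by positivity
  have hτD : τ * D < κ' := by
    have h1 : τ * (|D| + 1) = κ' / 2 := by
      rw [hτ]
      field_simp
    have h2 : τ * D ≤ τ * (|D| + 1) :=
      mul_le_mul_of_nonneg_left (by linarith [le_abs_self D]) hτ0.le
    linarith
  set η := τ / (1 + τ) with hη
  have hη0 : 0 < η := by positivity
  have hη1 : η < 1 := by
    rw [hη, div_lt_one (by positivity)]
    linarith
  have hητ : η / (1 - η) = τ := by
    rw [hη]
    field_simp
    ring
  have hx : ∀ ε : ℝ, 0 < ε → ∃ x ∈ allLyapunovTraces (fun j => (lam j)⁻¹) h,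
      x ≤ (1 - η) * p + ε := by
    intro ε hε
    obtain ⟨P, Γ, hP, hPD, hPp, hPR⟩ := hR ε hε
    obtain ⟨x, hx, hxle⟩ := exists_lyapunovTrace_le_of_riccatiBound hinj hlam hA hKh hK hκ'q
      hη0.le hη1 (by rw [hητ]; exact hτD) hP hPD hPR
    refine ⟨x, hx, hxle.trans ?_⟩
    nlinarith
  obtain ⟨x₁, hx₁, -⟩ := hx 1 one_pos
  obtain ⟨Γ, hΓ, v, hv, hvΓ⟩ := hconj ⟨x₁, hx₁⟩
  have hvle : v ≤ (1 - η) * p := by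
    refine le_of_forall_pos_le_add fun ε hε => ?_
    obtain ⟨x, hx, hxle⟩ := hx ε hε
    exact (hv.1 hx).trans hxle
  obtain ⟨δ, hδ, hδle⟩ := exists_pos_le_trace hk hlam (h := h) hΓ
  have hvδ : δ ≤ v := hvΓ.2 hδle
  -- For `p = 0` the bounds `δ ≤ v ≤ 0` are contradictory; for `p > 0` the factor `1 - η` gives
  -- strictness.
  have hvp : v < p := by
    rcases hp.eq_or_lt with h0 | h0
    · rw [← h0] at hvle
      linarith
    · nlinarith
  obtain ⟨x, ⟨Pw, J, hf, rfl⟩, hxp⟩ := (isGLB_lt_iff hvΓ).1 hvp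
  exact hf.exists_allocation hk hlam hΓ hxp

/-! ### Linear combinations of independent Gaussian vectors -/

section GaussianSpan

variable {Ω : Type*} {ι E : Type*} [NormedAddCommGroup E] [NormedSpace ℝ E]

/-- The random variables which are affine functions of finitely many of the vectors `B i`,
`i ∈ I`. -/
def gaussianSpan (B : ι → Ω → E) (I : Set ι) : Submodule ℝ (Ω → ℝ) :=
  Submodule.span ℝ ({fun _ => 1} ∪ {f | ∃ i ∈ I, ∃ l : E →L[ℝ] ℝ, f = fun ω => l (B i ω)})

lemma gaussianSpan_mono (B : ι → Ω → E) {I I' : Set ι} (h : I ⊆ I') :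
    gaussianSpan B I ≤ gaussianSpan B I' :=
  Submodule.span_mono (Set.union_subset_union_right _ fun _ ⟨i, hi, l, hf⟩ => ⟨i, h hi, l, hf⟩)

lemma const_mem_gaussianSpan (B : ι → Ω → E) (I : Set ι) (c : ℝ) :
    (fun _ => c) ∈ gaussianSpan B I := by
  have h1 := (gaussianSpan B I).smul_mem c (Submodule.subset_span (Or.inl rfl))
  convert h1 using 1
  ext ω
  simp

lemma apply_mem_gaussianSpan (B : ι → Ω → E) {I : Set ι} {i : ι} (hi : i ∈ I) (l : E →L[ℝ] ℝ) :
    (fun ω => l (B i ω)) ∈ gaussianSpan B I :=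
  Submodule.subset_span (Or.inr ⟨i, hi, l, rfl⟩)

lemma sum_mul_mem {J : Type*} (V : Submodule ℝ (Ω → ℝ)) (s : Finset J) (a : J → ℝ)
    {f : J → Ω → ℝ} (hf : ∀ j ∈ s, f j ∈ V) : (fun ω => ∑ j ∈ s, a j * f j ω) ∈ V := by
  have h1 := V.sum_mem fun j hj => V.smul_mem (a j) (hf j hj)
  convert h1 using 1
  ext ω
  simp

variable [MeasurableSpace Ω] {μ : Measure Ω}

lemma toLp_sum_eq {J : Type*} (s : Finset J) {f : J → Ω → ℝ} (hf : ∀ j, MemLp (f j) 2 μ)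
    (h : MemLp (fun ω => ∑ j ∈ s, f j ω) 2 μ) :
    h.toLp _ = ∑ j ∈ s, (hf j).toLp (f j) := by
  classical
  induction s using Finset.induction_on with
  | empty =>
    simp only [Finset.sum_empty] at h ⊢
    exact MemLp.toLp_zero h
  | insert a s ha ih =>
    rw [Finset.sum_insert ha, ← ih (memLp_finsetSum _ fun o _ => hf o), ← MemLp.toLp_add]
    refine MemLp.toLp_congr _ _ (Eventually.of_forall fun ω => ?_)
    simp [Finset.sum_insert ha]

lemma hasGaussianLaw_const_add {f : Ω → ℝ} (hf : HasGaussianLaw f μ) (c : ℝ) :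
    HasGaussianLaw (fun ω => c + f ω) μ where
  isGaussian_map := by
    have h1 := hf.isGaussian_map
    have h2 : μ.map (fun ω => c + f ω) = (μ.map f).map (fun x => c + x) := by
      rw [AEMeasurable.map_map_of_aemeasurable (by fun_prop) hf.aemeasurable]
      rfl
    rw [h2]
    infer_instance

/-- A vector all of whose linear functionals are Gaussian is Gaussian. -/
lemma hasGaussianLaw_of_forall_dual {F : Type*} [NormedAddCommGroup F] [NormedSpace ℝ F]
    [MeasurableSpace F] [BorelSpace F] {X : Ω → F} (hX : AEMeasurable X μ)
    (h : ∀ L : F →L[ℝ] ℝ, HasGaussianLaw (fun ω => L (X ω)) μ) : HasGaussianLaw X μ where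
  isGaussian_map := by
    refine isGaussian_of_isGaussian_map fun L => ?_
    rw [AEMeasurable.map_map_of_aemeasurable (by fun_prop) hX]
    exact (h L).isGaussian_map

variable [MeasurableSpace E] [BorelSpace E]

/-- Collecting the functionals by index makes each vector occur once, so the variable is a constant
plus a finite sum of independent Gaussians. -/
lemma hasGaussianLaw_of_mem_gaussianSpan {B : ι → Ω → E} (hB : ∀ i, HasGaussianLaw (B i) μ)
    (hind : iIndepFun B μ) {I : Set ι} {f : Ω → ℝ} (hf : f ∈ gaussianSpan B I) :
    HasGaussianLaw f μ := by
  classical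
  obtain ⟨c, l, hcl⟩ : ∃ (c : ℝ) (l : ι →₀ (E →L[ℝ] ℝ)),
      ∀ ω, f ω = c + l.sum fun i g => g (B i ω) := by
    induction hf using Submodule.span_induction with
    | mem f hf =>
      rcases hf with rfl | ⟨i, -, l, rfl⟩
      · exact ⟨1, 0, by simp⟩
      · exact ⟨0, Finsupp.single i l, by simp [Finsupp.sum_single_index]⟩
    | zero => exact ⟨0, 0, by simp⟩
    | add f g _ _ hf hg =>
      obtain ⟨c, l, hf⟩ := hf
      obtain ⟨c', l', hg⟩ := hg
      refine ⟨c + c', l + l', fun ω => ?_⟩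
      rw [Finsupp.sum_add_index' (by simp) (by simp), Pi.add_apply, hf, hg]
      ring
    | smul a f _ hf =>
      obtain ⟨c, l, hf⟩ := hf
      refine ⟨a * c, a • l, fun ω => ?_⟩
      rw [Finsupp.sum_smul_index' (by simp), Pi.smul_apply, hf, smul_eq_mul, mul_add, Finsupp.sum,
        Finsupp.sum, Finset.mul_sum]
      simp
  have h1 : iIndepFun (fun (i : l.support) ω => l i (B i ω)) μ :=
    (hind.precomp (g := fun i : l.support => (i : ι)) Subtype.val_injective).comp
      (fun i => l i) fun i => by fun_prop
  have h2 := hasGaussianLaw_const_add (iIndepFun.hasGaussianLaw_fun_sum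
    (fun i : l.support => (hB i).map_fun (l i)) h1) c
  have h3 : f = fun ω => c + ∑ i : l.support, l i (B i ω) := by
    ext ω
    rw [hcl, Finsupp.sum, Finset.sum_coe_sort l.support fun i => l i (B i ω)]
  rw [h3]
  exact h2

lemma memLp_of_mem_gaussianSpan {B : ι → Ω → E} (hB : ∀ i, HasGaussianLaw (B i) μ)
    (hind : iIndepFun B μ) {I : Set ι} {f : Ω → ℝ} (hf : f ∈ gaussianSpan B I) : MemLp f 2 μ :=
  (hasGaussianLaw_of_mem_gaussianSpan hB hind hf).memLp_two

/-- By linearity only the generators matter: the constant pairs to a vanishing mean, and a vector of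
another index is independent of `B i`. -/
lemma integral_mul_eq_zero_of_mem_gaussianSpan {B : ι → Ω → E} (hB : ∀ i, HasGaussianLaw (B i) μ)
    (hind : iIndepFun B μ) {I : Set ι} {f : Ω → ℝ} (hf : f ∈ gaussianSpan B I) {i : ι}
    (hi : i ∉ I) (l : E →L[ℝ] ℝ) (hl : ∫ ω, l (B i ω) ∂μ = 0) :
    ∫ ω, f ω * l (B i ω) ∂μ = 0 := by
  have hL : MemLp (fun ω => l (B i ω)) 2 μ := ((hB i).map_fun l).memLp_two
  induction hf using Submodule.span_induction with
  | mem f hf =>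
    rcases hf with rfl | ⟨j, hj, l', rfl⟩
    · simpa using hl
    · have hij : j ≠ i := fun h => hi (h ▸ hj)
      have h1 : IndepFun (fun ω => l' (B j ω)) (fun ω => l (B i ω)) μ :=
        (hind.indepFun hij).comp (φ := l') (ψ := l) (by fun_prop) (by fun_prop)
      rw [h1.integral_fun_mul_eq_mul_integral
        ((hB j).map_fun l').memLp_two.aestronglyMeasurable hL.aestronglyMeasurable, hl, mul_zero]
  | zero => simp
  | add f g hfm hgm hf hg =>
    simp only [Pi.add_apply, add_mul]
    rw [integral_add, hf, hg, add_zero]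
    · exact (memLp_of_mem_gaussianSpan hB hind hfm).integrable_mul hL
    · exact (memLp_of_mem_gaussianSpan hB hind hgm).integrable_mul hL
  | smul a f _ hf =>
    simp only [Pi.smul_apply, smul_eq_mul, mul_assoc]
    rw [integral_const_mul, hf, mul_zero]

variable [IsProbabilityMeasure μ]

/-- Linear regression of a square integrable random variable on finitely many others. -/
lemma exists_affine_regression {J : Type*} [Fintype J] {s : Ω → ℝ} {y : J → Ω → ℝ}
    (hs : MemLp s 2 μ) (hy : ∀ j, MemLp (y j) 2 μ) :
    ∃ (c : ℝ) (a : J → ℝ), ∫ ω, (s ω - (c + ∑ j, a j * y j ω)) ∂μ = 0 ∧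
      ∀ i, ∫ ω, (s ω - (c + ∑ j, a j * y j ω)) * y i ω ∂μ = 0 := by
  classical
  -- The index `none` carries the constant regressor, so orthogonality to it says that the residual
  -- is centred.
  let f : Option J → Ω → ℝ := fun o => o.elim (fun _ => 1) y
  have hf : ∀ o, MemLp (f o) 2 μ := by
    rintro (_ | j)
    · exact memLp_const 1
    · exact hy j
  let v : Option J → Lp ℝ 2 μ := fun o => (hf o).toLp (f o)
  let V := Submodule.span ℝ (Set.range v)
  have : FiniteDimensional ℝ V := FiniteDimensional.span_of_finite ℝ (Set.finite_range v)
  obtain ⟨c, hc⟩ := (Submodule.mem_span_range_iff_exists_fun ℝ).1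
    (V.starProjection_apply_mem (hs.toLp s))
  have hg : MemLp (fun ω => s ω - ∑ o, c o * f o ω) 2 μ :=
    hs.sub (memLp_finsetSum _ fun o _ => (hf o).const_mul (c o))
  have hgv : hg.toLp _ = hs.toLp s - V.starProjection (hs.toLp s) := by
    rw [← hc]
    have h1 : ∀ o, c o • v o = ((hf o).const_mul (c o)).toLp (fun ω => c o * f o ω) := fun o =>
      ((hf o).toLp_const_smul (c o)).symm
    simp only [h1]
    rw [← toLp_sum_eq _ _ (memLp_finsetSum _ fun o _ => (hf o).const_mul (c o)), ← MemLp.toLp_sub]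
    rfl
  have horth : ∀ o, ∫ ω, (s ω - ∑ o, c o * f o ω) * f o ω ∂μ = 0 := by
    intro o
    have h1 : inner ℝ (v o) (hg.toLp _) = 0 := by
      rw [hgv]
      exact V.sub_starProjection_mem_orthogonal (hs.toLp s) (v o)
        (Submodule.subset_span ⟨o, rfl⟩)
    rw [L2.inner_def] at h1
    rw [← h1]
    refine integral_congr_ae ?_
    filter_upwards [hg.coeFn_toLp, (hf o).coeFn_toLp] with ω h2 h3
    rw [h2]
    simp only [v]
    rw [h3]
    simp [mul_comm]
  have hsum : ∀ ω, ∑ o, c o * f o ω = c none + ∑ j, c (some j) * y j ω := by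
    intro ω
    rw [Fintype.sum_option]
    simp [f]
  refine ⟨c none, fun j => c (some j), ?_, fun i => ?_⟩
  · simpa [hsum, f] using horth none
  · simpa [hsum, f] using horth (some i)

/-- Gaussian regression: the residual is independent of the regressors. -/
lemma exists_indepFun_regression {B : ι → Ω → E} (hB : ∀ i, HasGaussianLaw (B i) μ)
    (hind : iIndepFun B μ) {I : Set ι} {N J : Type*} [Fintype N] [Fintype J] {s : N → Ω → ℝ}
    {y : J → Ω → ℝ} (hs : ∀ i, s i ∈ gaussianSpan B I) (hy : ∀ j, y j ∈ gaussianSpan B I) :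
    ∃ (r : N → Ω → ℝ) (c : N → ℝ) (a : N → J → ℝ),
      (∀ i ω, s i ω = r i ω + (c i + ∑ j, a i j * y j ω)) ∧ (∀ i, r i ∈ gaussianSpan B I) ∧
      (∀ i, ∫ ω, r i ω ∂μ = 0) ∧ IndepFun (fun ω i => r i ω) (fun ω j => y j ω) μ := by
  classical
  have hmem := fun {f : Ω → ℝ} (hf : f ∈ gaussianSpan B I) => memLp_of_mem_gaussianSpan hB hind hf
  choose c a h0 h1 using fun i => exists_affine_regression (hmem (hs i)) fun j => hmem (hy j)
  let r : N → Ω → ℝ := fun i ω => s i ω - (c i + ∑ j, a i j * y j ω)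
  have hr : ∀ i, r i ∈ gaussianSpan B I := fun i =>
    Submodule.sub_mem _ (hs i) (Submodule.add_mem _ (const_mem_gaussianSpan B I (c i))
      (sum_mul_mem _ _ _ fun j _ => hy j))
  refine ⟨r, c, a, fun i ω => by simp [r], hr, h0, ?_⟩
  -- Every functional of residual and regressors lies in the span, so they are jointly Gaussian, and
  -- zero correlation gives independence.
  refine HasGaussianLaw.indepFun_of_covariance_eval
    (hasGaussianLaw_of_forall_dual ?_ fun L => ?_) fun i j => ?_
  · exact (aemeasurable_pi_lambda _ fun i => (hmem (hr i)).aestronglyMeasurable.aemeasurable).prodMk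
      (aemeasurable_pi_lambda _ fun j => (hmem (hy j)).aestronglyMeasurable.aemeasurable)
  · refine hasGaussianLaw_of_mem_gaussianSpan hB hind (I := I) ?_
    have hL : (fun ω => L (fun i => r i ω, fun j => y j ω))
        = (fun ω => ∑ i, L (Pi.single i 1, 0) * r i ω) + fun ω => ∑ j, L (0, Pi.single j 1) * y j ω := by
      ext ω
      have h2 : ((fun i => r i ω, fun j => y j ω) : (N → ℝ) × (J → ℝ))
          = ∑ i, r i ω • ((Pi.single i 1, 0) : (N → ℝ) × (J → ℝ))
            + ∑ j, y j ω • ((0, Pi.single j 1) : (N → ℝ) × (J → ℝ)) := by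
        ext x
        · simp [Prod.fst_sum, Finset.sum_apply, Pi.single_apply]
        · simp [Prod.snd_sum, Finset.sum_apply, Pi.single_apply]
      rw [h2, map_add, map_sum, map_sum]
      simp only [map_smul, smul_eq_mul, mul_comm, Pi.add_apply]
    rw [hL]
    exact Submodule.add_mem _ (sum_mul_mem _ _ _ fun i _ => hr i) (sum_mul_mem _ _ _ fun j _ => hy j)
  · rw [covariance_eq_sub (hmem (hr i)) (hmem (hy j))]
    have h2 : ∫ ω, r i ω ∂μ = 0 := h0 i
    have h3 : ∫ ω, (r i * y j) ω ∂μ = 0 := h1 i j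
    rw [h2, h3]
    simp

end GaussianSpan

/-! ### The signals of a code as affine functions of its noise -/

namespace LinearCode
variable {Ω : Type*} [MeasurableSpace Ω] {μ : Measure Ω} {k n m : ℕ}
  {A Q : Matrix (Fin k) (Fin k) ℝ} {H : Matrix (Fin m) (Fin n) ℝ}
  {R : Matrix (Fin m) (Fin m) ℝ}

/-- The independent Gaussian vectors which drive a linear code, as vectors of a common space:
the initial state and, for each time, the source noise, the channel noise and the dither. -/
def noise (c : LinearCode μ A Q H R) : Unit ⊕ ℕ ⊕ ℕ ⊕ ℕ → Ω →
    EuclideanSpace ℝ (Fin k) × EuclideanSpace ℝ (Fin m) × EuclideanSpace ℝ (Fin n) :=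
  Sum.elim (fun _ ω => (c.S 0 ω, 0, 0)) (Sum.elim (fun t ω => (c.W t ω, 0, 0))
    (Sum.elim (fun t ω => (0, c.Z t ω, 0)) (fun t ω => (0, 0, c.M t ω))))

/-- The indices of the noise vectors which act before time `t`. -/
def noiseBefore (t : ℕ) : Set (Unit ⊕ ℕ ⊕ ℕ ⊕ ℕ) :=
  {i | Sum.elim (fun _ => True) (Sum.elim (· < t) (Sum.elim (· < t) (· < t))) i}

lemma noiseBefore_mono {s t : ℕ} (h : s ≤ t) : noiseBefore s ⊆ noiseBefore t := by
  rintro (_ | _ | _ | _) hi <;> simp [noiseBefore] at hi ⊢ <;> omega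

lemma iIndepFun_noise (c : LinearCode μ A Q H R) : iIndepFun c.noise μ := by
  rw [iIndepFun_iff_iIndep]
  refine (iIndep_iff _ _).2 fun s f hf => (iIndep_iff _ _).1 c.indep s fun i hi => ?_
  refine le_trans (b := MeasurableSpace.comap (c.noise i) inferInstance) ?_ ?_ _ (hf i hi)
  · exact le_rfl
  · rw [← measurable_iff_comap_le]
    rcases i with _ | t | t | t
    · exact (comap_measurable (c.S 0)).prodMk measurable_const
    · exact (comap_measurable (c.W t)).prodMk measurable_const
    · exact measurable_const.prodMk ((comap_measurable (c.Z t)).prodMk measurable_const)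
    · exact measurable_const.prodMk (measurable_const.prodMk (comap_measurable (c.M t)))

lemma hasGaussianLaw_noise (c : LinearCode μ A Q H R) (i) :
    HasGaussianLaw (c.noise i) μ := by
  have hU (f : EuclideanSpace ℝ (Fin k) →L[ℝ]
      EuclideanSpace ℝ (Fin k) × EuclideanSpace ℝ (Fin m) × EuclideanSpace ℝ (Fin n))
      {V : Ω → EuclideanSpace ℝ (Fin k)} (hV : μ.map V = multivariateGaussian 0 Q) :
      HasGaussianLaw (fun ω => f (V ω)) μ :=
    HasGaussianLaw.map_fun ⟨by rw [hV]; infer_instance⟩ f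
  rcases i with _ | t | t | t
  · exact hU (ContinuousLinearMap.inl ℝ _ _) c.law_S_zero
  · exact hU (ContinuousLinearMap.inl ℝ _ _) (c.law_W t)
  · exact HasGaussianLaw.map_fun ⟨by rw [c.law_Z t]; infer_instance⟩
      ((ContinuousLinearMap.inr ℝ (EuclideanSpace ℝ (Fin k)) _).comp
        (ContinuousLinearMap.inl ℝ (EuclideanSpace ℝ (Fin m)) (EuclideanSpace ℝ (Fin n))))
  · exact HasGaussianLaw.map_fun ⟨c.gaussian_M t⟩
      ((ContinuousLinearMap.inr ℝ (EuclideanSpace ℝ (Fin k)) _).comp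
        (ContinuousLinearMap.inr ℝ (EuclideanSpace ℝ (Fin m)) (EuclideanSpace ℝ (Fin n))))

lemma S_mem (c : LinearCode μ A Q H R) (t : ℕ) (i : Fin k) :
    (fun ω => c.S t ω i) ∈ gaussianSpan c.noise (noiseBefore t) := by
  induction t generalizing i with
  | zero =>
    exact apply_mem_gaussianSpan c.noise (i := Sum.inl ()) (by simp [noiseBefore])
      ((EuclideanSpace.proj i).comp (ContinuousLinearMap.fst ℝ _ _))
  | succ t ih =>
    have h1 : (fun ω => c.S (t + 1) ω i) =
        (fun ω => ∑ j, A i j * c.S t ω j) + fun ω => c.W t ω i := by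
      ext ω
      rw [c.source_eq]
      rfl
    rw [h1]
    refine Submodule.add_mem _ (sum_mul_mem _ _ _ fun j _ =>
      gaussianSpan_mono _ (noiseBefore_mono t.le_succ) (ih j)) ?_
    exact apply_mem_gaussianSpan c.noise (i := Sum.inr (Sum.inl t)) (by simp [noiseBefore])
      ((EuclideanSpace.proj i).comp (ContinuousLinearMap.fst ℝ _ _))

/-- Among the noise of time `t` the input involves only the dither, which makes it orthogonal to the
centred `W t` and `Z t`. The outputs enter as a hypothesis so that `Y_mem` can use this inside its
induction. -/
lemma X_mem_of_Y_mem (c : LinearCode μ A Q H R) (t : ℕ)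
    (hY : ∀ s < t, ∀ l, (fun ω => c.Y s ω l) ∈ gaussianSpan c.noise (noiseBefore t)) (i : Fin n) :
    (fun ω => c.X t ω i) ∈
      gaussianSpan c.noise (noiseBefore t ∪ {Sum.inr (Sum.inr (Sum.inr t))}) := by
  have h1 : (fun ω => c.X t ω i) =
      (∑ s ∈ Finset.range (t + 1), fun ω => ∑ j, c.srcCoeff t s i j * c.S s ω j) +
      (∑ s ∈ Finset.range t, fun ω => ∑ j, c.fbCoeff t s i j * c.Y s ω j) +
      fun ω => c.M t ω i := by
    ext ω
    rw [c.encoder_eq]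
    simp only [PiLp.add_apply, WithLp.ofLp_sum, Finset.sum_apply, Pi.add_apply]
    rfl
  rw [h1]
  refine Submodule.add_mem _ (Submodule.add_mem _
    (Submodule.sum_mem _ fun s hs => sum_mul_mem _ _ _ fun j _ => ?_)
    (Submodule.sum_mem _ fun s hs => sum_mul_mem _ _ _ fun j _ => ?_)) ?_
  · exact gaussianSpan_mono _ ((noiseBefore_mono (Nat.lt_succ_iff.1 (Finset.mem_range.1 hs))).trans
      Set.subset_union_left) (c.S_mem s j)
  · exact gaussianSpan_mono _ Set.subset_union_left (hY s (Finset.mem_range.1 hs) j)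
  · exact apply_mem_gaussianSpan c.noise (i := Sum.inr (Sum.inr (Sum.inr t))) (by simp)
      ((EuclideanSpace.proj i).comp ((ContinuousLinearMap.snd ℝ _ _).comp
        (ContinuousLinearMap.snd ℝ _ _)))

lemma Y_mem (c : LinearCode μ A Q H R) {s t : ℕ} (hst : s < t) (l : Fin m) :
    (fun ω => c.Y s ω l) ∈ gaussianSpan c.noise (noiseBefore t) := by
  induction s using Nat.strong_induction_on generalizing t l with
  | _ s ih =>
    have h1 : (fun ω => c.Y s ω l) = (fun ω => ∑ j, H l j * c.X s ω j) + fun ω => c.Z s ω l := by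
      ext ω
      rw [c.channel_eq]
      rfl
    rw [h1]
    refine Submodule.add_mem _ (sum_mul_mem _ _ _ fun j _ =>
      gaussianSpan_mono _ ?_ (c.X_mem_of_Y_mem s (fun r hr l => ih r hr hr l) j)) ?_
    · rw [Set.union_subset_iff, Set.singleton_subset_iff]
      exact ⟨noiseBefore_mono hst.le, by simpa [noiseBefore] using hst⟩
    · exact apply_mem_gaussianSpan c.noise (i := Sum.inr (Sum.inr (Sum.inl s)))
        (by simpa [noiseBefore] using hst)
        ((EuclideanSpace.proj l).comp ((ContinuousLinearMap.fst ℝ _ _).comp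
          (ContinuousLinearMap.snd ℝ _ _)))

lemma X_mem (c : LinearCode μ A Q H R) (t : ℕ) (i : Fin n) :
    (fun ω => c.X t ω i) ∈
      gaussianSpan c.noise (noiseBefore t ∪ {Sum.inr (Sum.inr (Sum.inr t))}) :=
  c.X_mem_of_Y_mem t (fun _ hs l => c.Y_mem hs l) i

lemma measurable_S (c : LinearCode μ A Q H R) (t : ℕ) : Measurable (c.S t) := by
  induction t with
  | zero => exact c.measurable_S_zero
  | succ t ih =>
    rw [show c.S (t + 1) = fun ω => Matrix.toEuclideanLin A (c.S t ω) + c.W t ω from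
      funext (c.source_eq t)]
    exact ((LinearMap.continuous_of_finiteDimensional _).measurable.comp ih).add (c.measurable_W t)

lemma measurable_X_of_Y (c : LinearCode μ A Q H R) (t : ℕ) (hY : ∀ s < t, Measurable (c.Y s)) :
    Measurable (c.X t) := by
  rw [show c.X t = _ from funext (c.encoder_eq t)]
  refine ((Finset.measurable_sum _ fun s _ => ?_).add
    (Finset.measurable_sum _ fun s hs => ?_)).add (c.measurable_M t)
  · exact (LinearMap.continuous_of_finiteDimensional _).measurable.comp (c.measurable_S s)
  · exact (LinearMap.continuous_of_finiteDimensional _).measurable.comp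
      (hY s (Finset.mem_range.1 hs))

lemma measurable_Y (c : LinearCode μ A Q H R) (t : ℕ) : Measurable (c.Y t) := by
  induction t using Nat.strong_induction_on with
  | _ t ih =>
    rw [show c.Y t = _ from funext (c.channel_eq t)]
    exact ((LinearMap.continuous_of_finiteDimensional _).measurable.comp
      (c.measurable_X_of_Y t ih)).add (c.measurable_Z t)

lemma measurable_pastOutputs (c : LinearCode μ A Q H R) (t : ℕ) : Measurable (c.pastOutputs t) :=
  measurable_pi_lambda _ fun s => c.measurable_Y s

end LinearCode

/-! ### Second moments of random vectors -/

section Moments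

variable {Ω : Type*} [MeasurableSpace Ω] {μ : Measure Ω}

lemma memLp_dotProduct {ι : Type*} [Fintype ι] {f : Ω → ι → ℝ}
    (hf : ∀ i, MemLp (fun ω => f ω i) 2 μ) (u : ι → ℝ) : MemLp (fun ω => u ⬝ᵥ f ω) 2 μ :=
  memLp_finsetSum _ fun i _ => (hf i).const_mul (u i)

lemma integral_dotProduct_mul {ι κ : Type*} [Fintype ι] [Fintype κ] {f : Ω → ι → ℝ}
    {g : Ω → κ → ℝ} (hf : ∀ i, MemLp (fun ω => f ω i) 2 μ) (hg : ∀ i, MemLp (fun ω => g ω i) 2 μ)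
    (u : ι → ℝ) (v : κ → ℝ) :
    ∫ ω, (u ⬝ᵥ f ω) * (v ⬝ᵥ g ω) ∂μ =
      u ⬝ᵥ (Matrix.of fun i j => ∫ ω, f ω i * g ω j ∂μ) *ᵥ v := by
  have h1 (i j) : Integrable (fun ω => u i * (v j * (f ω i * g ω j))) μ :=
    (((hf i).integrable_mul (hg j)).const_mul _).const_mul _
  have h2 : ∀ ω, (u ⬝ᵥ f ω) * (v ⬝ᵥ g ω) = ∑ i, ∑ j, u i * (v j * (f ω i * g ω j)) := by
    intro ω
    rw [dotProduct, dotProduct, Finset.sum_mul_sum]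
    exact Finset.sum_congr rfl fun i _ => Finset.sum_congr rfl fun j _ => by ring
  simp_rw [h2]
  rw [integral_finsetSum _ fun i _ => integrable_finsetSum _ fun j _ => h1 i j]
  refine Finset.sum_congr rfl fun i _ => ?_
  rw [integral_finsetSum _ fun j _ => h1 i j, Matrix.mulVec, dotProduct, Finset.mul_sum]
  refine Finset.sum_congr rfl fun j _ => ?_
  rw [integral_const_mul, integral_const_mul, Matrix.of_apply]
  ring

lemma integral_mul_dotProduct_eq_zero {ι : Type*} [Fintype ι] {f : Ω → ℝ} {g : Ω → ι → ℝ}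
    (hf : MemLp f 2 μ) (hg : ∀ i, MemLp (fun ω => g ω i) 2 μ) (h : ∀ i, ∫ ω, f ω * g ω i ∂μ = 0)
    (u : ι → ℝ) : ∫ ω, f ω * (u ⬝ᵥ g ω) ∂μ = 0 := by
  have h1 (i) : Integrable (fun ω => u i * (f ω * g ω i)) μ :=
    (hf.integrable_mul (hg i)).const_mul _
  have h2 : ∀ ω, f ω * (u ⬝ᵥ g ω) = ∑ i, u i * (f ω * g ω i) := by
    intro ω
    rw [dotProduct, Finset.mul_sum]
    exact Finset.sum_congr rfl fun i _ => by ring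
  simp_rw [h2]
  rw [integral_finsetSum _ fun i _ => h1 i]
  exact Finset.sum_eq_zero fun i _ => by rw [integral_const_mul, h i, mul_zero]

lemma integral_add_sq_of_integral_mul_eq_zero {f g : Ω → ℝ} (hf : MemLp f 2 μ) (hg : MemLp g 2 μ)
    (h : ∫ ω, f ω * g ω ∂μ = 0) :
    ∫ ω, (f ω + g ω) ^ 2 ∂μ = ∫ ω, f ω ^ 2 ∂μ + ∫ ω, g ω ^ 2 ∂μ := by
  have h1 : ∀ ω, (f ω + g ω) ^ 2 = f ω ^ 2 + g ω ^ 2 + 2 * (f ω * g ω) := fun ω => by ring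
  have h2 : Integrable (fun ω => f ω ^ 2 + g ω ^ 2) μ := hf.integrable_sq.add hg.integrable_sq
  have h3 : Integrable (fun ω => 2 * (f ω * g ω)) μ := (hf.integrable_mul hg).const_mul 2
  simp_rw [h1]
  rw [integral_add h2 h3, integral_add hf.integrable_sq hg.integrable_sq, integral_const_mul, h]
  ring

/-- The mean square of `f - g` is nonnegative. This form of the Cauchy–Schwarz inequality needs no
division and matches the variational form of the Riccati bound. -/
lemma two_mul_integral_mul_sub_le {f g : Ω → ℝ} (hf : MemLp f 2 μ) (hg : MemLp g 2 μ) :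
    2 * ∫ ω, f ω * g ω ∂μ - ∫ ω, g ω ^ 2 ∂μ ≤ ∫ ω, f ω ^ 2 ∂μ := by
  have h1 : 0 ≤ ∫ ω, (f ω - g ω) ^ 2 ∂μ := integral_nonneg fun ω => sq_nonneg _
  have h2 : ∀ ω, (f ω - g ω) ^ 2 = f ω ^ 2 + g ω ^ 2 - 2 * (f ω * g ω) := fun ω => by ring
  have h3 : Integrable (fun ω => f ω ^ 2 + g ω ^ 2) μ := hf.integrable_sq.add hg.integrable_sq
  have h4 : Integrable (fun ω => 2 * (f ω * g ω)) μ := (hf.integrable_mul hg).const_mul 2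
  simp_rw [h2] at h1
  rw [integral_sub h3 h4, integral_add hf.integrable_sq hg.integrable_sq,
    integral_const_mul] at h1
  linarith

lemma integral_eval_eq_zero_of_map_eq_multivariateGaussian {ι : Type*} [Fintype ι]
    [DecidableEq ι] {V : Ω → EuclideanSpace ℝ ι} (hVm : Measurable V) {C : Matrix ι ι ℝ}
    (hV : μ.map V = multivariateGaussian 0 C) (i : ι) :
    ∫ ω, V ω i ∂μ = 0 := by
  have hG : HasGaussianLaw V μ := ⟨by rw [hV]; infer_instance⟩
  have h1 : ∫ ω, V ω ∂μ = 0 := by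
    rw [← integral_map (f := fun x => x) hVm.aemeasurable (by fun_prop), hV,
      integral_id_multivariateGaussian]
  rw [← eval_integral_piLp fun i =>
    (hG.map_fun (EuclideanSpace.proj i : EuclideanSpace ℝ ι →L[ℝ] ℝ)).integrable, h1]
  rfl

lemma integral_dotProduct_sq_of_map_eq_multivariateGaussian {ι : Type*} [Fintype ι]
    [DecidableEq ι] {V : Ω → EuclideanSpace ℝ ι} (hVm : Measurable V) {C : Matrix ι ι ℝ}
    (hC : C.PosSemidef) (hV : μ.map V = multivariateGaussian 0 C) (u : ι → ℝ) :
    ∫ ω, (u ⬝ᵥ (V ω).ofLp) ^ 2 ∂μ = u ⬝ᵥ C *ᵥ u := by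
  have hG : HasGaussianLaw V μ := ⟨by rw [hV]; infer_instance⟩
  have hL2 (i) : MemLp (fun ω => V ω i) 2 μ :=
    (hG.map_fun (EuclideanSpace.proj i : EuclideanSpace ℝ ι →L[ℝ] ℝ)).memLp_two
  have hL2' (i) : MemLp (fun x : EuclideanSpace ℝ ι => x i) 2 (multivariateGaussian 0 C) := by
    rw [← hV]
    exact (memLp_map_measure_iff (by fun_prop) hVm.aemeasurable).2 (hL2 i)
  have h0 := integral_eval_eq_zero_of_map_eq_multivariateGaussian hVm hV
  have h1 (i j) : ∫ ω, V ω i * V ω j ∂μ = C i j := by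
    have h2 := covariance_eval_multivariateGaussian (μ := 0) hC i j
    rw [covariance_eq_sub (hL2' i) (hL2' j), ← hV, integral_map hVm.aemeasurable (by fun_prop),
      integral_map hVm.aemeasurable (by fun_prop), h0, zero_mul, sub_zero] at h2
    exact h2
  simp_rw [sq]
  rw [integral_dotProduct_mul hL2 hL2]
  simp only [h1]
  rfl

end Moments

/-! ### Residuals of the regression on past outputs -/

namespace LinearCode
variable {Ω : Type*} [MeasurableSpace Ω] {μ : Measure Ω} {k n m : ℕ}
  {A Q : Matrix (Fin k) (Fin k) ℝ} {H : Matrix (Fin m) (Fin n) ℝ}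
  {R : Matrix (Fin m) (Fin m) ℝ}

/-- `S t = r + b + ∑ s < t, a s * Y s` where `r` is centred, an affine function of the noise
before time `t`, and independent of the past outputs. -/
structure IsResidual (c : LinearCode μ A Q H R) (t : ℕ) (r : Ω → Fin k → ℝ) (b : Fin k → ℝ)
    (a : ℕ → Matrix (Fin k) (Fin m) ℝ) : Prop where
  S_eq : ∀ ω, (c.S t ω).ofLp = r ω + (b + ∑ s ∈ Finset.range t, a s *ᵥ (c.Y s ω).ofLp)
  mem : ∀ i, (fun ω => r ω i) ∈ gaussianSpan c.noise (noiseBefore t)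
  integral_eq_zero : ∀ i, ∫ ω, r ω i ∂μ = 0
  indepFun : IndepFun r (c.pastOutputs t) μ

lemma exists_isResidual [IsProbabilityMeasure μ] (c : LinearCode μ A Q H R) (t : ℕ) :
    ∃ r b a, c.IsResidual t r b a := by
  obtain ⟨r, b, a, h1, h2, h3, h4⟩ := exists_indepFun_regression c.hasGaussianLaw_noise
    c.iIndepFun_noise (s := fun i ω => c.S t ω i) (y := fun (j : Fin t × Fin m) ω => c.Y j.1 ω j.2)
    (c.S_mem t) (fun j => c.Y_mem j.1.2 j.2)
  refine ⟨fun ω i => r i ω, b,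
    fun s => Matrix.of fun i l => if h : s < t then a i (⟨s, h⟩, l) else 0, ?_, h2, h3, ?_⟩
  · intro ω
    ext i
    rw [h1 i ω, Fintype.sum_prod_type]
    simp only [Pi.add_apply, Finset.sum_apply, Finset.sum_range]
    congr 2
    refine Finset.sum_congr rfl fun s _ => Finset.sum_congr rfl fun l _ => ?_
    simp
  · have h5 : Measurable fun (y : Fin t × Fin m → ℝ) (s : Fin t) =>
        WithLp.toLp 2 fun l => y (s, l) := by
      fun_prop
    exact h4.comp measurable_id h5

namespace IsResidual

variable {c : LinearCode μ A Q H R} {t : ℕ} {r : Ω → Fin k → ℝ}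
  {b : Fin k → ℝ} {a : ℕ → Matrix (Fin k) (Fin m) ℝ}

lemma memLp (hr : c.IsResidual t r b a) (i) : MemLp (fun ω => r ω i) 2 μ :=
  memLp_of_mem_gaussianSpan c.hasGaussianLaw_noise c.iIndepFun_noise (hr.mem i)

lemma measurable (hr : c.IsResidual t r b a) (i) : Measurable fun ω => r ω i := by
  have h1 : (fun ω => r ω i) = fun ω => c.S t ω i -
      (b i + ∑ s ∈ Finset.range t, ∑ l, a s i l * c.Y s ω l) := by
    ext ω
    have h2 := congrFun (hr.S_eq ω) i
    simp only [Pi.add_apply, Finset.sum_apply] at h2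
    rw [h2]
    exact (add_sub_cancel_right _ _).symm
  rw [h1]
  have h2 := c.measurable_S t
  have h3 := c.measurable_Y
  fun_prop

lemma integral_mul_eq_zero [IsProbabilityMeasure μ] (hr : c.IsResidual t r b a) (i)
    {φ : (Fin t → EuclideanSpace ℝ (Fin m)) → ℝ} (hφ : Measurable φ) :
    ∫ ω, r ω i * φ (c.pastOutputs t ω) ∂μ = 0 := by
  have h1 : IndepFun (fun ω => r ω i) (fun ω => φ (c.pastOutputs t ω)) μ :=
    hr.indepFun.comp (measurable_pi_apply i) hφ
  rw [h1.integral_fun_mul_eq_mul_integral (hr.measurable i).aestronglyMeasurable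
    (hφ.comp (c.measurable_pastOutputs t)).aestronglyMeasurable, hr.integral_eq_zero, zero_mul]

/-- Given the past outputs, the affine part of `S t` is known and the residual, being independent of
them, has conditional mean zero. -/
lemma innovation_ae_eq [IsProbabilityMeasure μ] (hr : c.IsResidual t r b a) (i) :
    (fun ω => c.innovation t ω i) =ᵐ[μ] fun ω => r ω i := by
  have hm : MeasurableSpace.comap (c.pastOutputs t) inferInstance ≤ ‹MeasurableSpace Ω› :=
    (c.measurable_pastOutputs t).comap_le
  have hL2 (i) : MemLp (fun ω => c.S t ω i) 2 μ :=
    memLp_of_mem_gaussianSpan c.hasGaussianLaw_noise c.iIndepFun_noise (c.S_mem t i)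
  have hS : Integrable (c.S t) μ :=
    Integrable.of_eval_piLp fun i => (hL2 i).integrable one_le_two
  let φ : Ω → ℝ := fun ω => b i + ∑ s ∈ Finset.range t, (a s *ᵥ (c.Y s ω).ofLp) i
  have hφ : StronglyMeasurable[MeasurableSpace.comap (c.pastOutputs t) inferInstance] φ := by
    have h1 : φ = (fun q : Fin t → EuclideanSpace ℝ (Fin m) =>
        b i + ∑ s : Fin t, ∑ l, a s i l * q s l) ∘ c.pastOutputs t := by
      ext ω
      simp only [φ, Finset.sum_range, Function.comp_apply]
      rfl
    rw [h1]
    refine Measurable.stronglyMeasurable ?_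
    exact Measurable.comp (by fun_prop) (comap_measurable _)
  have hSi : (fun ω => c.S t ω i) = (fun ω => r ω i) + φ := by
    ext ω
    rw [hr.S_eq]
    simp [φ]
  have hri := (hr.memLp i).integrable one_le_two
  have hφi : Integrable φ μ := by
    have : φ = (fun ω => c.S t ω i) - fun ω => r ω i := by rw [hSi]; simp
    rw [this]
    exact ((hL2 i).integrable one_le_two).sub hri
  have h1 := ContinuousLinearMap.comp_condExp_comm
    (m := MeasurableSpace.comap (c.pastOutputs t) inferInstance) hS
    (EuclideanSpace.proj i : EuclideanSpace ℝ (Fin k) →L[ℝ] ℝ)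
  have h2 : μ[(EuclideanSpace.proj i : EuclideanSpace ℝ (Fin k) →L[ℝ] ℝ) ∘ c.S t |
      MeasurableSpace.comap (c.pastOutputs t) inferInstance] =ᵐ[μ] φ := by
    have h3 : (EuclideanSpace.proj i : EuclideanSpace ℝ (Fin k) →L[ℝ] ℝ) ∘ c.S t =
      (fun ω => r ω i) + φ := hSi
    rw [h3]
    have h4 := condExp_indep_eq (μ := μ) (f := fun ω => r ω i)
      (m₁ := MeasurableSpace.comap (fun ω => r ω i) inferInstance)
      (m₂ := MeasurableSpace.comap (c.pastOutputs t) inferInstance)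
      (hr.measurable i).comap_le hm (comap_measurable _).stronglyMeasurable
      ((IndepFun_iff_Indep _ _ _).1 (hr.indepFun.comp (measurable_pi_apply i) measurable_id))
    refine (condExp_add hri hφi _).trans ?_
    rw [condExp_of_stronglyMeasurable hm hφ hφi]
    filter_upwards [h4] with ω h5
    simp [h5, hr.integral_eq_zero]
  filter_upwards [h1, h2] with ω h3 h4
  have h5 := congrFun hSi ω
  have h6 : (μ[c.S t | MeasurableSpace.comap (c.pastOutputs t) inferInstance]) ω i = φ ω := by
    rw [← h4, ← h3]
    rfl
  simp only [innovation, PiLp.sub_apply, h6]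
  rw [h5]
  simp

lemma errorCov_eq [IsProbabilityMeasure μ] (hr : c.IsResidual t r b a) :
    c.errorCov t = Matrix.of fun i j => ∫ ω, r ω i * r ω j ∂μ := by
  ext i j
  refine integral_congr_ae ?_
  filter_upwards [hr.innovation_ae_eq i, hr.innovation_ae_eq j] with ω h1 h2
  rw [h1, h2]

lemma crossCov_eq [IsProbabilityMeasure μ] (hr : c.IsResidual t r b a) :
    c.crossCov t = Matrix.of fun i j => ∫ ω, c.X t ω i * r ω j ∂μ := by
  ext i j
  refine integral_congr_ae ?_
  filter_upwards [hr.innovation_ae_eq j] with ω h2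
  rw [h2]

end IsResidual

end LinearCode

/-! ### The Riccati inequality for the error covariances -/

namespace LinearCode
variable {Ω : Type*} [MeasurableSpace Ω] {μ : Measure Ω} {k n m : ℕ}
  {A Q : Matrix (Fin k) (Fin k) ℝ} {H : Matrix (Fin m) (Fin n) ℝ}
  {R : Matrix (Fin m) (Fin m) ℝ}

namespace IsResidual

variable {c : LinearCode μ A Q H R} {t : ℕ} {r r' : Ω → Fin k → ℝ}
  {b b' : Fin k → ℝ} {a a' : ℕ → Matrix (Fin k) (Fin m) ℝ}

/-- Substituting both regressions into the source equation isolates the fresh noises `W t` and `Z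
t`; the parenthesised difference depends only on the outputs before time `t`. -/
lemma dotProduct_succ_eq (hr : c.IsResidual t r b a) (hr' : c.IsResidual (t + 1) r' b' a')
    (u : Fin k → ℝ) (ω : Ω) :
    u ⬝ᵥ r' ω = (Aᵀ *ᵥ u) ⬝ᵥ r ω - (Hᵀ *ᵥ ((a' t)ᵀ *ᵥ u)) ⬝ᵥ (c.X t ω).ofLp
      - (u ⬝ᵥ (b' + ∑ s ∈ Finset.range t, a' s *ᵥ (c.Y s ω).ofLp)
        - (Aᵀ *ᵥ u) ⬝ᵥ (b + ∑ s ∈ Finset.range t, a s *ᵥ (c.Y s ω).ofLp))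
      + u ⬝ᵥ (c.W t ω).ofLp - ((a' t)ᵀ *ᵥ u) ⬝ᵥ (c.Z t ω).ofLp := by
  have h1 : (c.S (t + 1) ω).ofLp = A *ᵥ (c.S t ω).ofLp + (c.W t ω).ofLp := by
    rw [c.source_eq]
    rfl
  have h2 : (c.Y t ω).ofLp = H *ᵥ (c.X t ω).ofLp + (c.Z t ω).ofLp := by
    rw [c.channel_eq]
    rfl
  have h3 := hr'.S_eq ω
  rw [h1, hr.S_eq ω, Finset.sum_range_succ, h2] at h3
  have h4 := congrArg (u ⬝ᵥ ·) h3
  have h5 {κ : Type} [Fintype κ] {ι : Type} [Fintype ι] (N : Matrix κ ι ℝ) (x : κ → ℝ)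
      (y : ι → ℝ) : (Nᵀ *ᵥ x) ⬝ᵥ y = x ⬝ᵥ N *ᵥ y := by
    rw [Matrix.mulVec_transpose, Matrix.dotProduct_mulVec]
  simp only [dotProduct_add, Matrix.mulVec_add, h5] at h4 ⊢
  linarith

lemma integral_dotProduct_mul_eq_zero [IsProbabilityMeasure μ] (hr : c.IsResidual t r b a)
    (x : Fin k → ℝ) {φ : (Fin t → EuclideanSpace ℝ (Fin m)) → ℝ} (hφ : Measurable φ)
    (hL2 : MemLp (fun ω => φ (c.pastOutputs t ω)) 2 μ) :
    ∫ ω, (x ⬝ᵥ r ω) * φ (c.pastOutputs t ω) ∂μ = 0 := by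
  simp_rw [mul_comm (x ⬝ᵥ r _)]
  refine integral_mul_dotProduct_eq_zero hL2 hr.memLp (fun i => ?_) x
  simp_rw [mul_comm (φ _)]
  exact hr.integral_mul_eq_zero i hφ

end IsResidual

lemma memLp_of_mem (c : LinearCode μ A Q H R) {I : Set (Unit ⊕ ℕ ⊕ ℕ ⊕ ℕ)} {f : Ω → ℝ}
    (hf : f ∈ gaussianSpan c.noise I) : MemLp f 2 μ :=
  memLp_of_mem_gaussianSpan c.hasGaussianLaw_noise c.iIndepFun_noise hf

lemma memLp_X (c : LinearCode μ A Q H R) (t i) : MemLp (fun ω => c.X t ω i) 2 μ :=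
  c.memLp_of_mem (c.X_mem t i)

lemma W_mem (c : LinearCode μ A Q H R) {I : Set (Unit ⊕ ℕ ⊕ ℕ ⊕ ℕ)} {t : ℕ}
    (ht : Sum.inr (Sum.inl t) ∈ I) (i) : (fun ω => c.W t ω i) ∈ gaussianSpan c.noise I :=
  apply_mem_gaussianSpan c.noise ht
    ((EuclideanSpace.proj i).comp (ContinuousLinearMap.fst ℝ _ _))

lemma Z_mem (c : LinearCode μ A Q H R) {I : Set (Unit ⊕ ℕ ⊕ ℕ ⊕ ℕ)} {t : ℕ}
    (ht : Sum.inr (Sum.inr (Sum.inl t)) ∈ I) (i) : (fun ω => c.Z t ω i) ∈ gaussianSpan c.noise I :=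
  apply_mem_gaussianSpan c.noise ht
    ((EuclideanSpace.proj i).comp ((ContinuousLinearMap.fst ℝ _ _).comp
      (ContinuousLinearMap.snd ℝ _ _)))

lemma dotProduct_mem {ι : Type*} [Fintype ι] (c : LinearCode μ A Q H R)
    {I : Set (Unit ⊕ ℕ ⊕ ℕ ⊕ ℕ)} {f : Ω → ι → ℝ}
    (hf : ∀ i, (fun ω => f ω i) ∈ gaussianSpan c.noise I) (u : ι → ℝ) :
    (fun ω => u ⬝ᵥ f ω) ∈ gaussianSpan c.noise I :=
  sum_mul_mem _ _ u fun i _ => hf i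

lemma affine_mem (c : LinearCode μ A Q H R) (t : ℕ) (u b : Fin k → ℝ)
    (a : ℕ → Matrix (Fin k) (Fin m) ℝ) :
    (fun ω => u ⬝ᵥ (b + ∑ s ∈ Finset.range t, a s *ᵥ (c.Y s ω).ofLp)) ∈
      gaussianSpan c.noise (noiseBefore t) := by
  refine c.dotProduct_mem (fun i => ?_) u
  have h1 : (fun ω => (b + ∑ s ∈ Finset.range t, a s *ᵥ (c.Y s ω).ofLp) i) =
      (fun _ => b i) + ∑ s ∈ Finset.range t, fun ω => ∑ l, a s i l * c.Y s ω l := by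
    ext ω
    simp only [Pi.add_apply, Finset.sum_apply]
    rfl
  rw [h1]
  exact Submodule.add_mem _ (const_mem_gaussianSpan _ _ _)
    (Submodule.sum_mem _ fun s hs => sum_mul_mem _ _ _ fun l _ => c.Y_mem (Finset.mem_range.1 hs) l)

lemma integral_mul_dotProduct_W_eq_zero (c : LinearCode μ A Q H R) {I : Set (Unit ⊕ ℕ ⊕ ℕ ⊕ ℕ)}
    {t : ℕ} (ht : Sum.inr (Sum.inl t) ∉ I) {f : Ω → ℝ} (hf : f ∈ gaussianSpan c.noise I)
    (u : Fin k → ℝ) : ∫ ω, f ω * (u ⬝ᵥ (c.W t ω).ofLp) ∂μ = 0 := by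
  refine integral_mul_dotProduct_eq_zero (c.memLp_of_mem hf)
    (fun i => c.memLp_of_mem (c.W_mem (Set.mem_singleton _) i)) (fun i => ?_) u
  exact integral_mul_eq_zero_of_mem_gaussianSpan c.hasGaussianLaw_noise c.iIndepFun_noise hf ht
    ((EuclideanSpace.proj i).comp (ContinuousLinearMap.fst ℝ _ _))
    (integral_eval_eq_zero_of_map_eq_multivariateGaussian (c.measurable_W t) (c.law_W t) i)

lemma integral_mul_dotProduct_Z_eq_zero (c : LinearCode μ A Q H R) {I : Set (Unit ⊕ ℕ ⊕ ℕ ⊕ ℕ)}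
    {t : ℕ} (ht : Sum.inr (Sum.inr (Sum.inl t)) ∉ I) {f : Ω → ℝ}
    (hf : f ∈ gaussianSpan c.noise I) (u : Fin m → ℝ) :
    ∫ ω, f ω * (u ⬝ᵥ (c.Z t ω).ofLp) ∂μ = 0 := by
  refine integral_mul_dotProduct_eq_zero (c.memLp_of_mem hf)
    (fun i => c.memLp_of_mem (c.Z_mem (Set.mem_singleton _) i)) (fun i => ?_) u
  exact integral_mul_eq_zero_of_mem_gaussianSpan c.hasGaussianLaw_noise c.iIndepFun_noise hf ht
    ((EuclideanSpace.proj i).comp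
        ((ContinuousLinearMap.fst ℝ _ _).comp (ContinuousLinearMap.snd ℝ _ _)))
    (integral_eval_eq_zero_of_map_eq_multivariateGaussian (c.measurable_Z t) (c.law_Z t) i)

lemma isHermitian_errorCov (c : LinearCode μ A Q H R) (t : ℕ) : (c.errorCov t).IsHermitian := by
  ext i j
  simp [errorCov, mul_comm]

/-- The next error is `f + u·W - y·Z` with mutually orthogonal terms, where `y` is the regression
weight of the newest output. Testing `f` against `x·r` with `x = Aᵀ u - v` removes the dependence on
past outputs and leaves only `P` and `Γ`. Minimising over the unknown `y` turns `R` into `R⁻¹`, so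
neither the optimal filter gain nor the full input covariance is needed. -/
lemma riccatiBound_errorCov [IsProbabilityMeasure μ] (c : LinearCode μ A Q H R) (hQ : Q.PosDef)
    (hR : R.PosDef) (t : ℕ) :
    RiccatiBound A (Hᵀ * R⁻¹ * H) (fun u => u ⬝ᵥ Q *ᵥ u) (c.errorCov t) (c.errorCov (t + 1))
      (c.crossCov t) := by
  intro u v
  obtain ⟨r, b, a, hr⟩ := c.exists_isResidual t
  obtain ⟨r', b', a', hr'⟩ := c.exists_isResidual (t + 1)
  set w := Aᵀ *ᵥ u with hw
  set y := (a' t)ᵀ *ᵥ u with hy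
  set x := w - v with hx
  let ψ : (Fin t → EuclideanSpace ℝ (Fin m)) → ℝ := fun q =>
    u ⬝ᵥ (b' + ∑ s : Fin t, a' s *ᵥ (q s).ofLp) - w ⬝ᵥ (b + ∑ s : Fin t, a s *ᵥ (q s).ofLp)
  have hψm : Measurable ψ := by
    simp only [ψ, dotProduct, Matrix.mulVec, Pi.add_apply, Finset.sum_apply]
    fun_prop
  have hψ : ∀ ω, ψ (c.pastOutputs t ω) =
      u ⬝ᵥ (b' + ∑ s ∈ Finset.range t, a' s *ᵥ (c.Y s ω).ofLp)
        - w ⬝ᵥ (b + ∑ s ∈ Finset.range t, a s *ᵥ (c.Y s ω).ofLp) := by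
    intro ω
    simp only [Finset.sum_range]
    rfl
  have hψS : (fun ω => ψ (c.pastOutputs t ω)) ∈ gaussianSpan c.noise (noiseBefore t) := by
    simp only [hψ]
    exact Submodule.sub_mem _ (c.affine_mem t u b' a') (c.affine_mem t w b a)
  let I : Set (Unit ⊕ ℕ ⊕ ℕ ⊕ ℕ) := noiseBefore t ∪ {Sum.inr (Sum.inr (Sum.inr t))}
  let f : Ω → ℝ := fun ω =>
    w ⬝ᵥ r ω - (Hᵀ *ᵥ y) ⬝ᵥ (c.X t ω).ofLp - ψ (c.pastOutputs t ω)
  have hfI : f ∈ gaussianSpan c.noise I :=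
    Submodule.sub_mem _ (Submodule.sub_mem _
      (gaussianSpan_mono _ Set.subset_union_left (c.dotProduct_mem hr.mem w))
      (c.dotProduct_mem (c.X_mem t) _)) (gaussianSpan_mono _ Set.subset_union_left hψS)
  have hW : (fun ω => u ⬝ᵥ (c.W t ω).ofLp) ∈
      gaussianSpan c.noise (I ∪ {Sum.inr (Sum.inl t)}) :=
    c.dotProduct_mem (c.W_mem (by simp)) u
  have hZ : (fun ω => (-y) ⬝ᵥ (c.Z t ω).ofLp) ∈ gaussianSpan c.noise Set.univ :=
    c.dotProduct_mem (c.Z_mem (by simp)) _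
  have hfW : (fun ω => f ω + u ⬝ᵥ (c.W t ω).ofLp) ∈
      gaussianSpan c.noise (I ∪ {Sum.inr (Sum.inl t)}) :=
    Submodule.add_mem _ (gaussianSpan_mono _ Set.subset_union_left hfI) hW
  have h1 : u ⬝ᵥ c.errorCov (t + 1) *ᵥ u =
      ∫ ω, f ω ^ 2 ∂μ + u ⬝ᵥ Q *ᵥ u + y ⬝ᵥ R *ᵥ y := by
    have h2 : ∀ ω, (u ⬝ᵥ r' ω) * (u ⬝ᵥ r' ω) =
        (f ω + u ⬝ᵥ (c.W t ω).ofLp + (-y) ⬝ᵥ (c.Z t ω).ofLp) ^ 2 := by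
      intro ω
      rw [← sq, hr.dotProduct_succ_eq hr' u ω, ← hψ, neg_dotProduct, ← sub_eq_add_neg]
    rw [hr'.errorCov_eq, ← integral_dotProduct_mul hr'.memLp hr'.memLp]
    simp_rw [h2]
    rw [integral_add_sq_of_integral_mul_eq_zero (c.memLp_of_mem hfW) (c.memLp_of_mem hZ)
        (c.integral_mul_dotProduct_Z_eq_zero (by simp [I, noiseBefore]) hfW _),
      integral_add_sq_of_integral_mul_eq_zero (c.memLp_of_mem hfI) (c.memLp_of_mem hW)
        (c.integral_mul_dotProduct_W_eq_zero (by simp [I, noiseBefore]) hfI _),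
      integral_dotProduct_sq_of_map_eq_multivariateGaussian (c.measurable_W t) hQ.posSemidef
        (c.law_W t),
      integral_dotProduct_sq_of_map_eq_multivariateGaussian (c.measurable_Z t) hR.posSemidef
        (c.law_Z t), Matrix.mulVec_neg, dotProduct_neg, neg_dotProduct, neg_neg]
  have hxr := memLp_dotProduct hr.memLp x
  have h3 := two_mul_integral_mul_sub_le (c.memLp_of_mem hfI) hxr
  have h4 : ∫ ω, (x ⬝ᵥ r ω) ^ 2 ∂μ = x ⬝ᵥ c.errorCov t *ᵥ x := by
    simp_rw [sq]
    rw [hr.errorCov_eq, integral_dotProduct_mul hr.memLp hr.memLp]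
  have h5 : ∫ ω, f ω * (x ⬝ᵥ r ω) ∂μ =
      w ⬝ᵥ c.errorCov t *ᵥ x - (Hᵀ *ᵥ y) ⬝ᵥ c.crossCov t *ᵥ x := by
    have h6 : ∀ ω, f ω * (x ⬝ᵥ r ω) = (w ⬝ᵥ r ω) * (x ⬝ᵥ r ω)
        - ((Hᵀ *ᵥ y) ⬝ᵥ (c.X t ω).ofLp) * (x ⬝ᵥ r ω)
        - (x ⬝ᵥ r ω) * ψ (c.pastOutputs t ω) := fun ω => by
      simp only [f]
      ring
    have h7 : Integrable (fun ω => (w ⬝ᵥ r ω) * (x ⬝ᵥ r ω)) μ :=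
      (memLp_dotProduct hr.memLp w).integrable_mul hxr
    have h8 : Integrable (fun ω => ((Hᵀ *ᵥ y) ⬝ᵥ (c.X t ω).ofLp) * (x ⬝ᵥ r ω)) μ :=
      (memLp_dotProduct (c.memLp_X t) _).integrable_mul hxr
    have h9 : Integrable (fun ω => (x ⬝ᵥ r ω) * ψ (c.pastOutputs t ω)) μ :=
      hxr.integrable_mul (c.memLp_of_mem hψS)
    have h10 : Integrable (fun ω => (w ⬝ᵥ r ω) * (x ⬝ᵥ r ω)
        - ((Hᵀ *ᵥ y) ⬝ᵥ (c.X t ω).ofLp) * (x ⬝ᵥ r ω)) μ := h7.sub h8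
    simp_rw [h6]
    rw [integral_sub h10 h9, integral_sub h7 h8,
      hr.integral_dotProduct_mul_eq_zero x hψm (c.memLp_of_mem hψS),
      integral_dotProduct_mul hr.memLp hr.memLp, integral_dotProduct_mul (c.memLp_X t) hr.memLp,
      ← hr.errorCov_eq, ← hr.crossCov_eq, sub_zero]
  have h10 : (Hᵀ *ᵥ y) ⬝ᵥ c.crossCov t *ᵥ x = (H *ᵥ (c.crossCov t *ᵥ x)) ⬝ᵥ y := by
    rw [Matrix.mulVec_transpose, ← Matrix.dotProduct_mulVec, dotProduct_comm]
  have h11 := hR.le_inv_quadratic (H *ᵥ (c.crossCov t *ᵥ x)) y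
  have h12 : c.crossCov t *ᵥ x ⬝ᵥ (Hᵀ * R⁻¹ * H) *ᵥ (c.crossCov t *ᵥ x) =
      H *ᵥ (c.crossCov t *ᵥ x) ⬝ᵥ R⁻¹ *ᵥ (H *ᵥ (c.crossCov t *ᵥ x)) := by
    rw [← Matrix.mulVec_mulVec, ← Matrix.mulVec_mulVec, dotProduct_transpose_mulVec]
  have h13 := dotProduct_mulVec_sub_self (c.isHermitian_errorCov t) w x
  have h14 : w - x = v := by rw [hx]; abel
  rw [h14] at h13
  change u ⬝ᵥ Q *ᵥ u + w ⬝ᵥ c.errorCov t *ᵥ w - v ⬝ᵥ c.errorCov t *ᵥ v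
    - c.crossCov t *ᵥ x ⬝ᵥ (Hᵀ * R⁻¹ * H) *ᵥ (c.crossCov t *ᵥ x) ≤ _
  rw [h4, h5] at h3
  rw [h1, h12]
  rw [h10] at h3
  linarith

/-- The choice `v = Aᵀ u` cancels every term except the source noise. -/
lemma dotProduct_le_errorCov_succ [IsProbabilityMeasure μ] (c : LinearCode μ A Q H R)
    (hQ : Q.PosDef) (hR : R.PosDef) (t : ℕ) (u : Fin k → ℝ) :
    u ⬝ᵥ Q *ᵥ u ≤ u ⬝ᵥ c.errorCov (t + 1) *ᵥ u := by
  simpa using c.riccatiBound_errorCov hQ hR t u (Aᵀ *ᵥ u)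

lemma posDef_errorCov_succ [IsProbabilityMeasure μ] (c : LinearCode μ A Q H R)
    (hQ : Q.PosDef) (hR : R.PosDef) (t : ℕ) : (c.errorCov (t + 1)).PosDef := by
  refine Matrix.PosDef.of_dotProduct_mulVec_pos (c.isHermitian_errorCov _) fun u hu => ?_
  exact (hQ.dotProduct_mulVec_pos hu).trans_le (c.dotProduct_le_errorCov_succ hQ hR t u)

end LinearCode

/-! ### Power and distortion constraints, and the conclusion -/

lemma lintegral_enorm_sq_eq_ofReal {Ω ι : Type*} [MeasurableSpace Ω] {μ : Measure Ω} [Fintype ι]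
    {V : Ω → EuclideanSpace ℝ ι} (hV : ∀ i, MemLp (fun ω => V ω i) 2 μ) :
    ∫⁻ ω, ‖V ω‖ₑ ^ 2 ∂μ = ENNReal.ofReal (∑ i, ∫ ω, V ω i ^ 2 ∂μ) := by
  have h1 : ∀ ω, ‖V ω‖ₑ ^ 2 = ENNReal.ofReal (∑ i, V ω i ^ 2) := by
    intro ω
    rw [← EuclideanSpace.real_norm_sq_eq, ENNReal.ofReal_pow (norm_nonneg _), ofReal_norm]
  simp_rw [h1]
  rw [← integral_finsetSum _ fun i _ => (hV i).integrable_sq, ofReal_integral_eq_lintegral_ofReal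
    (integrable_finsetSum _ fun i _ => (hV i).integrable_sq)
    (Eventually.of_forall fun ω => Finset.sum_nonneg fun i _ => sq_nonneg _)]

lemma eventually_sum_le_of_limsup_le {f : ℕ → ℝ≥0∞} {a : ℕ → ℝ} {p q : ℝ}
    (h : limsup (fun T : ℕ => (∑ t ∈ Finset.Icc 1 T, f t) / (T : ℝ≥0∞)) atTop ≤ ENNReal.ofReal p)
    (ha : ∀ t, 0 ≤ a t) (haf : ∀ t, ENNReal.ofReal (a t) ≤ f t) (hq : 0 < q) (hpq : p < q) :
    ∀ᶠ T : ℕ in atTop, ∑ t ∈ Finset.Icc 1 T, a t ≤ q * T := by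
  have h1 := eventually_lt_of_limsup_lt (h.trans_lt ((ENNReal.ofReal_lt_ofReal_iff hq).2 hpq))
  filter_upwards [h1, eventually_ge_atTop 1] with T h2 hT
  have hT0 : (T : ℝ≥0∞) ≠ 0 := by
    have : T ≠ 0 := by omega
    exact_mod_cast this
  have h3 := (ENNReal.div_lt_iff (Or.inl hT0) (Or.inl (ENNReal.natCast_ne_top T))).1 h2
  have h4 : (0 : ℝ) ≤ q * T := by positivity
  rw [← ENNReal.ofReal_le_ofReal_iff h4, ENNReal.ofReal_sum_of_nonneg fun t _ => ha t,
    ENNReal.ofReal_mul hq.le, ENNReal.ofReal_natCast]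
  exact (Finset.sum_le_sum fun t _ => haf t).trans h3.le

namespace LinearCode
variable {Ω : Type*} [MeasurableSpace Ω] {μ : Measure Ω} {k n m : ℕ}
  {A Q : Matrix (Fin k) (Fin k) ℝ} {H : Matrix (Fin m) (Fin n) ℝ}
  {R : Matrix (Fin m) (Fin m) ℝ}

lemma trace_inputMoment (c : LinearCode μ A Q H R) (t : ℕ) :
    (c.inputMoment t).trace = ∑ i, ∫ ω, c.X t ω i ^ 2 ∂μ := by
  simp [Matrix.trace, inputMoment, sq]

/-- The mean square of `X - L r`, with `r` the residual, is nonnegative. -/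
lemma trace_le_trace_inputMoment [IsProbabilityMeasure μ] (c : LinearCode μ A Q H R) (t : ℕ)
    (L : Matrix (Fin n) (Fin k) ℝ) :
    2 * (L * (c.crossCov t)ᵀ).trace - (L * c.errorCov t * Lᵀ).trace ≤
      (c.inputMoment t).trace := by
  obtain ⟨r, b, a, hr⟩ := c.exists_isResidual t
  have h1 (i : Fin n) : 2 * (L * (c.crossCov t)ᵀ) i i - (L * c.errorCov t * Lᵀ) i i ≤
      ∫ ω, c.X t ω i ^ 2 ∂μ := by
    have h2 := two_mul_integral_mul_sub_le (c.memLp_X t i) (memLp_dotProduct hr.memLp (L i))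
    have h3 : ∫ ω, c.X t ω i * (L i ⬝ᵥ r ω) ∂μ = (L * (c.crossCov t)ᵀ) i i := by
      have h4 := integral_dotProduct_mul (c.memLp_X t) hr.memLp (Pi.single i 1) (L i)
      rw [← hr.crossCov_eq] at h4
      simp only [single_one_dotProduct] at h4
      rw [h4, Matrix.mulVec, dotProduct_comm]
      rfl
    have h5 : ∫ ω, (L i ⬝ᵥ r ω) ^ 2 ∂μ = (L * c.errorCov t * Lᵀ) i i := by
      simp_rw [sq]
      rw [integral_dotProduct_mul hr.memLp hr.memLp, ← hr.errorCov_eq, Matrix.dotProduct_mulVec]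
      rfl
    rwa [h3, h5] at h2
  rw [trace_inputMoment, Matrix.trace, Matrix.trace, Finset.mul_sum, ← Finset.sum_sub_distrib]
  exact Finset.sum_le_sum fun i _ => h1 i

/-- The error of any decoder is the residual plus a function of past outputs; when it is square
integrable the two are orthogonal, so the residual has the smaller mean square. -/
lemma ofReal_trace_errorCov_le [IsProbabilityMeasure μ] (c : LinearCode μ A Q H R) (t : ℕ) :
    ENNReal.ofReal (c.errorCov t).trace ≤ ∫⁻ ω, ‖c.S t ω - c.estimate t ω‖ₑ ^ 2 ∂μ := by
  rcases eq_or_ne (∫⁻ ω, ‖c.S t ω - c.estimate t ω‖ₑ ^ 2 ∂μ) ⊤ with htop | htop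
  · rw [htop]
    exact le_top
  obtain ⟨r, b, a, hr⟩ := c.exists_isResidual t
  have hm : Measurable fun ω => c.S t ω - c.estimate t ω :=
    (c.measurable_S t).sub ((c.measurable_g t).comp (c.measurable_pastOutputs t))
  have he : MemLp (fun ω => c.S t ω - c.estimate t ω) 2 μ := by
    refine ⟨hm.aestronglyMeasurable, ?_⟩
    rw [eLpNorm_lt_top_iff_lintegral_rpow_enorm_lt_top two_ne_zero ENNReal.ofNat_ne_top]
    simpa using htop.lt_top
  have hei := memLp_piLp_iff.1 he
  rw [lintegral_enorm_sq_eq_ofReal hei]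
  refine ENNReal.ofReal_le_ofReal (Finset.sum_le_sum fun i _ => ?_)
  let φ : (Fin t → EuclideanSpace ℝ (Fin m)) → ℝ := fun q =>
    (b i + ∑ s : Fin t, (a s *ᵥ (q s).ofLp) i) - c.g t q i
  have hφm : Measurable φ := by
    have := c.measurable_g t
    simp only [φ, Matrix.mulVec, dotProduct]
    fun_prop
  have hφ : ∀ ω, (c.S t ω - c.estimate t ω) i = r ω i + φ (c.pastOutputs t ω) := by
    intro ω
    rw [PiLp.sub_apply, hr.S_eq]
    simp only [Pi.add_apply, Finset.sum_apply, Finset.sum_range, estimate, φ, pastOutputs]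
    ring
  have hφ2 : MemLp (fun ω => φ (c.pastOutputs t ω)) 2 μ := by
    have h1 : (fun ω => φ (c.pastOutputs t ω)) =
        (fun ω => (c.S t ω - c.estimate t ω) i) - fun ω => r ω i := by
      ext ω
      rw [Pi.sub_apply, hφ]
      ring
    rw [h1]
    exact (hei i).sub (hr.memLp i)
  simp_rw [hφ]
  rw [integral_add_sq_of_integral_mul_eq_zero (hr.memLp i) hφ2 (hr.integral_mul_eq_zero i hφm),
    hr.errorCov_eq]
  simp_rw [sq]
  exact le_add_of_nonneg_right (integral_nonneg fun ω => mul_self_nonneg _)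

lemma trace_errorCov_nonneg (c : LinearCode μ A Q H R) (t : ℕ) : 0 ≤ (c.errorCov t).trace :=
  Finset.sum_nonneg fun _ _ => integral_nonneg fun _ => mul_self_nonneg _

lemma PowerConstraint.eventually_le {c : LinearCode μ A Q H R} {p : ℝ} (h : c.PowerConstraint p)
    {q : ℝ} (hq : 0 < q) (hpq : p < q) :
    ∀ᶠ T : ℕ in atTop, ∑ t ∈ Finset.Icc 1 T, (c.inputMoment t).trace ≤ q * T := by
  refine eventually_sum_le_of_limsup_le h (fun t => ?_) (fun t => ?_) hq hpq
  · rw [trace_inputMoment]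
    exact Finset.sum_nonneg fun i _ => integral_nonneg fun ω => sq_nonneg _
  · rw [lintegral_enorm_sq_eq_ofReal (c.memLp_X t), trace_inputMoment]

lemma DistortionConstraint.eventually_le [IsProbabilityMeasure μ] {c : LinearCode μ A Q H R}
    {D : ℝ} (h : c.DistortionConstraint D) {q : ℝ} (hq : 0 < q) (hDq : D < q) :
    ∀ᶠ T : ℕ in atTop, ∑ t ∈ Finset.Icc 1 T, (c.errorCov t).trace ≤ q * T :=
  eventually_sum_le_of_limsup_le h c.trace_errorCov_nonneg c.ofReal_trace_errorCov_le hq hDq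

end LinearCode

lemma LinearCode.exists_riccatiBound_of_isTimeInvariant {Ω : Type*} [MeasurableSpace Ω]
    {μ : Measure Ω} [IsProbabilityMeasure μ] {k n m : ℕ} {A Q : Matrix (Fin k) (Fin k) ℝ}
    {H : Matrix (Fin m) (Fin n) ℝ} {R : Matrix (Fin m) (Fin m) ℝ} {c : LinearCode μ A Q H R}
    (hc : c.IsTimeInvariant) (hQ : Q.PosDef) (hR : R.PosDef) {κ D p : ℝ} (hκ : 0 < κ)
    (hD : ∀ᶠ T : ℕ in atTop, ∑ t ∈ Finset.Icc 1 T, (c.errorCov t).trace ≤ D * T)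
    (hp : ∀ᶠ T : ℕ in atTop, ∑ t ∈ Finset.Icc 1 T, (c.inputMoment t).trace ≤ p * T) :
    ∃ (P : Matrix (Fin k) (Fin k) ℝ) (Γ : Matrix (Fin n) (Fin k) ℝ), P.PosDef ∧
      P.trace ≤ D ∧ (Γ * P⁻¹ * Γᵀ).trace ≤ p ∧
      RiccatiBound A (Hᵀ * R⁻¹ * H) (fun u => u ⬝ᵥ Q *ᵥ u - κ / 2 * (u ⬝ᵥ u)) P P Γ := by
  have hP (t : ℕ) (ht : 1 ≤ t) : (c.errorCov t).PosDef := by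
    obtain ⟨s, rfl⟩ := Nat.exists_eq_add_of_le' ht
    exact c.posDef_errorCov_succ hQ hR s
  have hRic := c.riccatiBound_errorCov hQ hR
  have hν := c.trace_le_trace_inputMoment
  rcases hc.2 with ⟨Γ, hΓ⟩ | ⟨G, hG⟩
  · simp only [hΓ] at hRic hν
    exact exists_riccatiBound_of_const_crossCov hκ hP (fun t _ => hRic t) (fun t _ => hν t) hD hp
  · have hΓ (t : ℕ) (ht : 1 ≤ t) : c.crossCov t = G * c.errorCov t := by
      rw [← hG t, Matrix.nonsing_inv_mul_cancel_right _ _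
        ((Matrix.isUnit_iff_isUnit_det _).1 (hP t ht).isUnit)]
    have hK : (Hᵀ * R⁻¹ * H).PosSemidef := by
      simpa using hR.inv.posSemidef.conjTranspose_mul_mul_same H
    exact exists_riccatiBound_of_const_gain hQ hK hκ hP (c.dotProduct_le_errorCov_succ hQ hR 0)
      (fun t ht => hΓ t ht ▸ hRic t) (fun t ht => hΓ t ht ▸ hν t) hD hp

theorem mainTheorem3 {k n m : ℕ} (hk : 0 < k)
    (A Q : Matrix (Fin k) (Fin k) ℝ) (hQ : Q.PosDef)
    (lam : Fin k → ℝ) (hlam_inj : Function.Injective lam) (hlam : ∀ j, 1 < |lam j|)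
    (hA : A.charpoly = ∏ j, (Polynomial.X - Polynomial.C (lam j)))
    (H : Matrix (Fin m) (Fin n) ℝ) (R : Matrix (Fin m) (Fin m) ℝ) (hR : R.PosDef)
    (h : Fin n → ℝ)
    (hH : (Hᵀ * R⁻¹ * H).charpoly = ∏ i, (Polynomial.X - Polynomial.C (h i ^ 2)))
    (p : ℝ) (hp : 0 ≤ p)
    (hconj : LyapunovPositivity (fun j => (lam j)⁻¹) h)
    (hach : FiniteMSEAchievable A Q H R p) :
    ∃ (S : Fin n → Finset (Fin k)) (pw : Fin n → ℝ),
      IsStabilizingAllocation lam h p S pw := by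
  obtain ⟨Ω, _, μ, _, c, D, hti, hpow, hdist⟩ := hach
  obtain ⟨κ, hκ, hκQ⟩ := hQ.exists_pos_le
  have hK : (Hᵀ * R⁻¹ * H).PosSemidef := by
    simpa using hR.inv.posSemidef.conjTranspose_mul_mul_same H
  -- A limsup bound holds along averages only after enlarging it, and the enlarged bound has to be
  -- positive; hence `max D 0 + 1` and `p + ε`.
  refine exists_allocation_of_riccatiBound hk hlam_inj hlam hA hK.isHermitian hH hp hconj hκ hκQ
    (D := max D 0 + 1) fun ε hε => c.exists_riccatiBound_of_isTimeInvariant hti hQ hR hκ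
      (hdist.eventually_le ?_ ?_) (hpow.eventually_le ?_ ?_)
  · positivity
  · linarith [le_max_left D 0]
  · linarith
  · linarith
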